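/- Theorem 5.1. Let $p$ be a prime number and let $\Gamma$ be a countable, residually finite (discrete) group. Notation. Let $c_0(\Gamma)$ be the $\mathbb{Q}_p$-algebra of formal series $x=\sum_{\gamma\in\Gamma} x_\gamma\gamma$ with $x_\gamma\in\mathbb{Q}_p$ and $|x_\gamma|_p\to 0$ as $\gamma\to\infty$ (that is, for every $\varepsilon>0$ only finitely many $\gamma$ satisfy $|x_\gamma|_p\ge\varepsilon$), with the convolution product $\left(\sum_\gamma x_\gamma\gamma\right)\left(\sum_\gamma y_\gamma\gamma\right)=\sum_\gamma\left(\sum_{\gamma'\gamma''=\gamma}x_{\gamma'}y_{\gamma''}\right)\gamma$ and the norm $\|x\|=\sup_\gamma|x_\gamma|_p$. Let $c_0(\Gamma,\mathbb{Z}_p)\subset c_0(\Gamma)$ be the subring of series with all coefficients in $\mathbb{Z}_p$. For a unital ring $R$ let $\mathrm{GL}_\infty(R)$ be the union of the groups $\mathrm{GL}_r(R)$ along the embeddings $a\mapsto\left(\begin{smallmatrix}a&0\\0&1\end{smallmatrix}\right)$, let $E_\infty(R)$ be the union of the subgroups $E_r(R)\subset \mathrm{GL}_r(R)$ generated by the elementary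 matrices (those with $1$'s on the diagonal and at most one further non-zero entry), and let $K_1(R)=\mathrm{GL}_\infty(R)/E_\infty(R)$, an abelian group. Let $Wh^{\mathbb{F}_p}(\Gamma)=K_1(\mathbb{F}_p[\Gamma])/\langle\Gamma\rangle$, where $\langle\Gamma\rangle$ is the image of $\Gamma$ under $\Gamma\to\mathbb{F}_p[\Gamma]^*\to K_1(\mathbb{F}_p[\Gamma])$. For $r\ge1$ and a matrix $b=(b_{ij})\in M_r(c_0(\Gamma))$ let $\mathrm{tr}_\Gamma(b)\in\mathbb{Q}_p$ be the coefficient of the neutral element $e\in\Gamma$ in $\sum_i b_{ii}\in c_0(\Gamma)$. The set $1+pM_r(c_0(\Gamma,\mathbb{Z}_p))$ of $1$-units is contained in $\mathrm{GL}_r(c_0(\Gamma,\mathbb{Z}_p))$, and for a $1$-unit $u$ the series $\log u=-\sum_{\nu=1}^\infty \frac{(1-u)^\nu}{\nu}$ converges in $M_r(c_0(\Gamma))$ for the norm $\|(b_{ij})\|=\max_{i,j}\|b_{ij}\|$. Claim. Assume that $Wh^{\mathbb{F}_p}(\Gamma)$ is a torsion group. Then there is a unique group homomorphism $$\log_p\mathrm{det}_\Gamma\colon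 K_1(c_0(\Gamma,\mathbb{Z}_p))\longrightarrow\mathbb{Q}_p$$ with the following two properties: (a) for every $r\ge1$ and every $u\in 1+pM_r(c_0(\Gamma,\mathbb{Z}_p))$, the class $[u]$ of $u\in\mathrm{GL}_r(c_0(\Gamma,\mathbb{Z}_p))$ in $K_1(c_0(\Gamma,\mathbb{Z}_p))$ satisfies $\log_p\mathrm{det}_\Gamma([u])=\mathrm{tr}_\Gamma(\log u)$; (b) $\log_p\mathrm{det}_\Gamma$ vanishes on the image of $\Gamma$ in $K_1(c_0(\Gamma,\mathbb{Z}_p))$. -/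

import Mathlib

open Filter Topology

/-! ### The group `K₁` of a unital ring -/

section K1

variable {R : Type*} [Ring R]

/-- The block matrix `(a, 0; 0, 1)` of size `n ≥ m` attached to a matrix `a` of size `m`. -/
def stabMatrix {m n : ℕ} (a : Matrix (Fin m) (Fin m) R) : Matrix (Fin n) (Fin n) R :=
  fun i j => if h : i.1 < m ∧ j.1 < m then a ⟨i.1, h.1⟩ ⟨j.1, h.2⟩ else if i = j then 1 else 0

theorem stabMatrix_one {m n : ℕ} :
    stabMatrix (1 : Matrix (Fin m) (Fin m) R) = (1 : Matrix (Fin n) (Fin n) R) := by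
  ext i j
  simp only [stabMatrix, Matrix.one_apply, Fin.ext_iff]
  split_ifs <;> rfl

theorem stabMatrix_mul {m n : ℕ} (h : m ≤ n) (a b : Matrix (Fin m) (Fin m) R) :
    (stabMatrix (a * b) : Matrix (Fin n) (Fin n) R) = stabMatrix a * stabMatrix b := by
  ext i j
  rw [Matrix.mul_apply]
  by_cases hi : i.1 < m
  · have key : ∑ k : Fin m, a ⟨i.1, hi⟩ k * (stabMatrix b : Matrix (Fin n) (Fin n) R)
        (Fin.castLE h k) j = ∑ k : Fin n, stabMatrix a i k * stabMatrix b k j := by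
      refine Fintype.sum_of_injective (Fin.castLE h) (Fin.castLE_injective h) _ _ ?_ ?_
      · intro k hk
        have hk' : ¬ k.1 < m := fun hk' => hk ⟨⟨k.1, hk'⟩, by ext; rfl⟩
        have hik : i ≠ k := by rintro rfl; exact hk' hi
        simp [stabMatrix, hk', hik]
      · intro k
        simp [stabMatrix, hi]
    rw [← key]
    by_cases hj : j.1 < m
    · simp [stabMatrix, hi, hj, Matrix.mul_apply]
    · have hij : i ≠ j := by rintro rfl; exact hj hi
      have : ∀ k : Fin m, Fin.castLE h k ≠ j := by
        rintro k rfl; exact hj k.2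
      simp [stabMatrix, hj, hij, this]
  · have hz : ∀ k, (stabMatrix a : Matrix (Fin n) (Fin n) R) i k = if i = k then 1 else 0 := by
      intro k; simp [stabMatrix, hi]
    simp only [hz, ite_mul, one_mul, zero_mul, Finset.sum_ite_eq, Finset.mem_univ, if_true]
    simp [stabMatrix, hi]

/-- The stabilization homomorphism `GL_m(R) → GL_n(R)`, `a ↦ (a, 0; 0, 1)`, for `m ≤ n`. -/
def stabGL {m n : ℕ} (h : m ≤ n) :
    Matrix.GeneralLinearGroup (Fin m) R →* Matrix.GeneralLinearGroup (Fin n) R :=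
  Units.map ⟨⟨stabMatrix, stabMatrix_one⟩, stabMatrix_mul h⟩

variable (R)

instance stabGL_directedSystem :
    DirectedSystem (fun n : ℕ => Matrix.GeneralLinearGroup (Fin n) R)
      (fun _ _ h => (stabGL h : _ →* _)) where
  map_self n a := by
    apply Units.ext
    ext i j
    simp [stabGL, stabMatrix]
  map_map k j i hij hjk a := by
    apply Units.ext
    ext u v
    simp only [stabGL, stabMatrix, Units.coe_map, MonoidHom.coe_mk, OneHom.coe_mk, Fin.ext_iff]
    split_ifs <;> first | rfl | (exfalso; omega)

/-- `GL_∞(R)`, the union of the groups `GL_n(R)` along `a ↦ (a, 0; 0, 1)`. -/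
abbrev GLInf : Type _ :=
  DirectLimit (fun n : ℕ => Matrix.GeneralLinearGroup (Fin n) R)
    (fun _ _ h => (stabGL h : _ →* _))

/-- The canonical map `GL_n(R) → GL_∞(R)`. -/
noncomputable def GLInf.of (n : ℕ) : Matrix.GeneralLinearGroup (Fin n) R →* GLInf R where
  toFun a := (⟦⟨n, a⟩⟧ : DirectLimit (fun n : ℕ => Matrix.GeneralLinearGroup (Fin n) R)
    (fun _ _ h => (stabGL h : _ →* _)))
  map_one' := (DirectLimit.one_def n).symm
  map_mul' a b := (DirectLimit.mul_def (G := fun n : ℕ => Matrix.GeneralLinearGroup (Fin n) R)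
    (f := fun _ _ h => (stabGL h : _ →* _)) n a b).symm

theorem GLInf.of_stab {m n : ℕ} (h : m ≤ n) (a : Matrix.GeneralLinearGroup (Fin m) R) :
    GLInf.of R n (stabGL h a) = GLInf.of R m a :=
  (DirectLimit.eq_of_le (F := fun n : ℕ => Matrix.GeneralLinearGroup (Fin n) R)
    (f := fun _ _ h => (stabGL h : _ →* _)) ⟨m, a⟩ n h).symm

/-- The subgroup of `GL_n(R)` generated by the elementary matrices, i.e. those with `1`'s on the
diagonal and at most one further non-zero entry. -/
def elementaryGroup (n : Type*) [Fintype n] [DecidableEq n] :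
    Subgroup (Matrix.GeneralLinearGroup n R) :=
  Subgroup.closure {g | ∃ (i j : n) (c : R), i ≠ j ∧
    (g : Matrix n n R) = 1 + Matrix.single i j c}

/-- `E_∞(R)`, the union of (the images of) the groups `E_n(R)` in `GL_∞(R)`. -/
noncomputable def EInf : Subgroup (GLInf R) :=
  ⨆ n : ℕ, (elementaryGroup R (Fin n)).map (GLInf.of R n)

variable {R}

section Whitehead

variable {n : Type*} [Fintype n] [DecidableEq n]

open Matrix in
/-- Block upper unipotent matrices. -/
def upperUnit (B : Matrix n n R) : Matrix.GeneralLinearGroup (n ⊕ n) R where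
  val := fromBlocks 1 B 0 1
  inv := fromBlocks 1 (-B) 0 1
  val_inv := by simp [fromBlocks_multiply]
  inv_val := by simp [fromBlocks_multiply]

open Matrix in
/-- Block lower unipotent matrices. -/
def lowerUnit (B : Matrix n n R) : Matrix.GeneralLinearGroup (n ⊕ n) R where
  val := fromBlocks 1 0 B 1
  inv := fromBlocks 1 0 (-B) 1
  val_inv := by simp [fromBlocks_multiply]
  inv_val := by simp [fromBlocks_multiply]

open Matrix in
theorem upperUnit_mem (B : Matrix n n R) : upperUnit B ∈ elementaryGroup R (n ⊕ n) := by
  induction B using Matrix.induction_on' with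
  | h_zero =>
    convert one_mem (elementaryGroup R (n ⊕ n))
    apply Units.ext
    simp [upperUnit]
  | h_add p q hp hq =>
    convert mul_mem hp hq
    apply Units.ext
    simp [upperUnit, fromBlocks_multiply, add_comm]
  | h_std_basis i j x =>
    refine Subgroup.subset_closure ⟨Sum.inl i, Sum.inr j, x, by simp, ?_⟩
    ext (a | a) (b | b) <;> simp [upperUnit, Matrix.one_apply, Matrix.single_apply]

open Matrix in
theorem lowerUnit_mem (B : Matrix n n R) : lowerUnit B ∈ elementaryGroup R (n ⊕ n) := by
  induction B using Matrix.induction_on' with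
  | h_zero =>
    convert one_mem (elementaryGroup R (n ⊕ n))
    apply Units.ext
    simp [lowerUnit]
  | h_add p q hp hq =>
    convert mul_mem hp hq
    apply Units.ext
    simp [lowerUnit, fromBlocks_multiply]
  | h_std_basis i j x =>
    refine Subgroup.subset_closure ⟨Sum.inr i, Sum.inl j, x, by simp, ?_⟩
    ext (a | a) (b | b) <;> simp [lowerUnit, Matrix.one_apply, Matrix.single_apply]

open Matrix in
/-- The block diagonal matrix with blocks `g`, `h`. -/
def diagUnit (g h : Matrix.GeneralLinearGroup n R) :
    Matrix.GeneralLinearGroup (n ⊕ n) R where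
  val := fromBlocks g.val 0 0 h.val
  inv := fromBlocks g.inv 0 0 h.inv
  val_inv := by simp [fromBlocks_multiply]
  inv_val := by simp [fromBlocks_multiply]

open Matrix in
theorem diagUnit_inv_mem (g : Matrix.GeneralLinearGroup n R) :
    diagUnit g g⁻¹ ∈ elementaryGroup R (n ⊕ n) := by
  have : diagUnit g g⁻¹ = upperUnit g.val * lowerUnit (-g.inv) * upperUnit g.val *
      (upperUnit (-1) * lowerUnit 1 * upperUnit (-1)) := by
    apply Units.ext
    simp [diagUnit, upperUnit, lowerUnit, fromBlocks_multiply]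
  rw [this]
  exact mul_mem (mul_mem (mul_mem (upperUnit_mem _) (lowerUnit_mem _)) (upperUnit_mem _))
    (mul_mem (mul_mem (upperUnit_mem _) (lowerUnit_mem _)) (upperUnit_mem _))

open Matrix in
theorem diagUnit_commutator_mem (g h : Matrix.GeneralLinearGroup n R) :
    diagUnit (g * h * g⁻¹ * h⁻¹) 1 ∈ elementaryGroup R (n ⊕ n) := by
  have : diagUnit (g * h * g⁻¹ * h⁻¹) 1 =
      diagUnit g g⁻¹ * diagUnit h h⁻¹ * diagUnit (h * g)⁻¹ (h * g)⁻¹⁻¹ := by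
    apply Units.ext
    simp [diagUnit, fromBlocks_multiply, mul_assoc]
  rw [this]
  exact mul_mem (mul_mem (diagUnit_inv_mem _) (diagUnit_inv_mem _)) (diagUnit_inv_mem _)

/-- Reindexing of invertible matrices. -/
def reindexGL {m n : Type*} [Fintype m] [DecidableEq m] [Fintype n] [DecidableEq n] (e : m ≃ n) :
    Matrix.GeneralLinearGroup m R →* Matrix.GeneralLinearGroup n R :=
  Units.map ((Matrix.reindexRingEquiv R e : Matrix m m R →+* Matrix n n R) :
    Matrix m m R →* Matrix n n R)

theorem reindexGL_mem {m n : Type*} [Fintype m] [DecidableEq m] [Fintype n] [DecidableEq n]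
    (e : m ≃ n) {g : Matrix.GeneralLinearGroup m R} (hg : g ∈ elementaryGroup R m) :
    reindexGL e g ∈ elementaryGroup R n := by
  have : elementaryGroup R m ≤ (elementaryGroup R n).comap (reindexGL e) := by
    refine (Subgroup.closure_le _).2 ?_
    rintro g ⟨i, j, c, hij, hg⟩
    refine Subgroup.subset_closure ⟨e i, e j, c, by simpa using hij, ?_⟩
    ext a b
    simp [reindexGL, hg, Matrix.one_apply, Matrix.single_apply, Equiv.eq_symm_apply]
  exact this hg

theorem stabGL_eq_reindexGL {n : ℕ} (g : Matrix.GeneralLinearGroup (Fin n) R) :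
    stabGL (Nat.le_add_right n n) g = reindexGL finSumFinEquiv (diagUnit g 1) := by
  apply Units.ext
  ext i j
  obtain ⟨i, rfl⟩ := finSumFinEquiv.surjective i
  obtain ⟨j, rfl⟩ := finSumFinEquiv.surjective j
  rcases i with i | i <;> rcases j with j | j <;>
    simp [stabGL, stabMatrix, reindexGL, diagUnit, Fin.ext_iff, Matrix.one_apply,
      -Fin.natAdd_eq_addNat]
  all_goals omega

end Whitehead

theorem commutator_mem_EInf (x y : GLInf R) : x * y * x⁻¹ * y⁻¹ ∈ EInf R := by
  obtain ⟨n, g, h, rfl, rfl⟩ := DirectLimit.exists_eq_mk₂ _ x y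
  have : GLInf.of R (n + n) (stabGL (Nat.le_add_right n n) (g * h * g⁻¹ * h⁻¹)) ∈ EInf R := by
    rw [stabGL_eq_reindexGL]
    exact (le_iSup (fun n : ℕ => (elementaryGroup R (Fin n)).map (GLInf.of R n)) (n + n))
      ⟨_, reindexGL_mem _ (diagUnit_commutator_mem g h), rfl⟩
  rw [GLInf.of_stab, map_mul, map_mul, map_mul, map_inv, map_inv] at this
  exact this

instance EInf_normal : (EInf R).Normal where
  conj_mem x hx y := by
    have := mul_mem (commutator_mem_EInf y x) hx
    simpa using this

variable (R) in
/-- `K₁(R) = GL_∞(R) / E_∞(R)`. -/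
def K1 : Type _ := GLInf R ⧸ EInf R

noncomputable instance K1.instCommGroup : CommGroup (K1 R) where
  __ := (inferInstance : Group (GLInf R ⧸ EInf R))
  mul_comm a b := by
    induction a, b using Quotient.inductionOn₂' with
    | h x y =>
      refine QuotientGroup.eq.2 ?_
      simpa [mul_assoc] using commutator_mem_EInf y⁻¹ x⁻¹

variable (R) in
/-- The canonical map `GL_n(R) → K₁(R)`. -/
noncomputable def K1.ofGL (n : ℕ) : Matrix.GeneralLinearGroup (Fin n) R →* K1 R :=
  (QuotientGroup.mk' (EInf R)).comp (GLInf.of R n)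

variable (R) in
/-- The canonical map `Rˣ = GL_1(R) → K₁(R)`. -/
noncomputable def K1.ofUnits : Rˣ →* K1 R :=
  (K1.ofGL R 1).comp (Matrix.GeneralLinearGroup.scalar (Fin 1))

end K1

/-- The Whitehead group `Wh^{𝔽_p}(Γ) = K₁(𝔽_p[Γ]) / ⟨Γ⟩`, where `⟨Γ⟩` is the image of `Γ` under
`Γ → 𝔽_p[Γ]ˣ → K₁(𝔽_p[Γ])`. -/
abbrev WhiteheadFp (p : ℕ) [Fact p.Prime] (Γ : Type*) [Group Γ] : Type _ :=
  K1 (MonoidAlgebra (ZMod p) Γ) ⧸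
    ((K1.ofUnits (MonoidAlgebra (ZMod p) Γ)).comp
      (MonoidAlgebra.of (ZMod p) Γ).toHomUnits).range

/-! ### The convolution algebra `c₀(Γ)` -/

/-- `c₀(Γ)`: the formal series `∑ x_γ γ` with coefficients `x_γ ∈ ℚ_p` such that `|x_γ|_p → 0` as
`γ → ∞`, i.e. along the cofinite filter of `Γ`. -/
@[ext]
structure C0 (p : ℕ) [Fact p.Prime] (Γ : Type*) where
  /-- The coefficient of `γ`. -/
  coeff : Γ → ℚ_[p]
  tendsto_zero : Tendsto coeff cofinite (𝓝 0)

namespace C0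

noncomputable section

variable {p : ℕ} [Fact p.Prime] {Γ : Type*}

theorem coeff_injective : Function.Injective (coeff : C0 p Γ → Γ → ℚ_[p]) :=
  fun _ _ h => C0.ext h

instance : Zero (C0 p Γ) := ⟨⟨0, tendsto_const_nhds⟩⟩

instance : Add (C0 p Γ) :=
  ⟨fun x y => ⟨x.coeff + y.coeff, by simpa [Pi.add_def] using x.tendsto_zero.add y.tendsto_zero⟩⟩

instance : Neg (C0 p Γ) := ⟨fun x => ⟨-x.coeff, by simpa [Pi.neg_def] using x.tendsto_zero.neg⟩⟩

instance : Sub (C0 p Γ) :=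
  ⟨fun x y => ⟨x.coeff - y.coeff, by simpa [Pi.sub_def] using x.tendsto_zero.sub y.tendsto_zero⟩⟩

instance {S : Type*} [SMulZeroClass S ℚ_[p]] [ContinuousConstSMul S ℚ_[p]] : SMul S (C0 p Γ) :=
  ⟨fun c x => ⟨c • x.coeff, by simpa [Pi.smul_def] using x.tendsto_zero.const_smul c⟩⟩

@[simp] theorem coeff_zero (γ : Γ) : (0 : C0 p Γ).coeff γ = 0 := rfl
@[simp] theorem coeff_add (x y : C0 p Γ) (γ : Γ) : (x + y).coeff γ = x.coeff γ + y.coeff γ := rfl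
@[simp] theorem coeff_neg (x : C0 p Γ) (γ : Γ) : (-x).coeff γ = -x.coeff γ := rfl
@[simp] theorem coeff_sub (x y : C0 p Γ) (γ : Γ) : (x - y).coeff γ = x.coeff γ - y.coeff γ := rfl
@[simp] theorem coeff_smul (c : ℚ_[p]) (x : C0 p Γ) (γ : Γ) :
    (c • x).coeff γ = c * x.coeff γ := rfl

instance : AddCommGroup (C0 p Γ) :=
  coeff_injective.addCommGroup _ rfl (fun _ _ => rfl) (fun _ => rfl) (fun _ _ => rfl)
    (fun _ _ => rfl) (fun _ _ => rfl)

/-- Coefficients as an additive homomorphism. -/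
def coeffHom : C0 p Γ →+ (Γ → ℚ_[p]) where
  toFun := coeff
  map_zero' := rfl
  map_add' _ _ := rfl

instance : Module ℚ_[p] (C0 p Γ) :=
  coeff_injective.module ℚ_[p] coeffHom (fun _ _ => rfl)

theorem bddAbove (x : C0 p Γ) : BddAbove (Set.range fun γ => ‖x.coeff γ‖) :=
  x.tendsto_zero.norm.bddAbove_range_of_cofinite

/-- The norm `‖∑ x_γ γ‖ = sup_γ |x_γ|_p`. -/
instance : Norm (C0 p Γ) := ⟨fun x => ⨆ γ, ‖x.coeff γ‖⟩

theorem norm_def (x : C0 p Γ) : ‖x‖ = ⨆ γ, ‖x.coeff γ‖ := rfl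

theorem norm_coeff_le (x : C0 p Γ) (γ : Γ) : ‖x.coeff γ‖ ≤ ‖x‖ := le_ciSup x.bddAbove γ

theorem norm_le {x : C0 p Γ} {C : ℝ} (hC : 0 ≤ C) (h : ∀ γ, ‖x.coeff γ‖ ≤ C) : ‖x‖ ≤ C :=
  Real.iSup_le h hC

theorem norm_nonneg' (x : C0 p Γ) : 0 ≤ ‖x‖ := Real.iSup_nonneg fun _ => norm_nonneg _

instance : NormedAddCommGroup (C0 p Γ) :=
  AddGroupNorm.toNormedAddCommGroup
    { toFun := fun x => ‖x‖
      map_zero' := le_antisymm (norm_le le_rfl (by simp)) (norm_nonneg' _)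
      add_le' := fun x y => norm_le (add_nonneg (norm_nonneg' _) (norm_nonneg' _)) fun γ =>
        (norm_add_le _ _).trans (add_le_add (norm_coeff_le x γ) (norm_coeff_le y γ))
      neg' := fun x => by simp [norm_def]
      eq_zero_of_map_eq_zero' := fun x hx => by
        ext γ
        exact norm_le_zero_iff.1 ((norm_coeff_le x γ).trans_eq hx) }

instance : IsUltrametricDist (C0 p Γ) :=
  IsUltrametricDist.isUltrametricDist_of_isNonarchimedean_norm fun x y =>
    norm_le (le_max_of_le_left (norm_nonneg' _)) fun γ =>
      (IsUltrametricDist.norm_add_le_max _ _).trans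
        (max_le_max (norm_coeff_le x γ) (norm_coeff_le y γ))

instance : CompleteSpace (C0 p Γ) := by
  refine Metric.complete_of_cauchySeq_tendsto fun u hu => ?_
  have hu' : ∀ ε > 0, ∃ N, ∀ m ≥ N, ∀ n ≥ N, ‖u m - u n‖ < ε := by
    simpa only [dist_eq_norm] using Metric.cauchySeq_iff.1 hu
  have hc : ∀ γ, CauchySeq fun n => (u n).coeff γ := fun γ => by
    refine Metric.cauchySeq_iff.2 fun ε hε => ?_
    obtain ⟨N, hN⟩ := hu' ε hε
    refine ⟨N, fun m hm n hn => ?_⟩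
    rw [dist_eq_norm]
    exact (norm_coeff_le (u m - u n) γ).trans_lt (hN m hm n hn)
  choose y hy using fun γ => cauchySeq_tendsto_of_complete (hc γ)
  have hle : ∀ ε > 0, ∃ N, ∀ n ≥ N, ∀ γ, ‖(u n).coeff γ - y γ‖ ≤ ε := by
    intro ε hε
    obtain ⟨N, hN⟩ := hu' ε hε
    refine ⟨N, fun n hn γ => ?_⟩
    refine le_of_tendsto ((tendsto_const_nhds.sub (hy γ)).norm) ?_
    filter_upwards [eventually_ge_atTop N] with m hm
    exact ((norm_coeff_le (u n - u m) γ)).trans (hN n hn m hm).le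
  have hy0 : Tendsto y cofinite (𝓝 0) := by
    refine Metric.tendsto_nhds.2 fun ε hε => ?_
    obtain ⟨N, hN⟩ := hle (ε / 2) (half_pos hε)
    filter_upwards [Metric.tendsto_nhds.1 (u N).tendsto_zero (ε / 2) (half_pos hε)] with γ hγ
    rw [dist_zero_right] at hγ ⊢
    have h1 := hN N le_rfl γ
    have h2 : ‖y γ‖ ≤ ‖(u N).coeff γ‖ + ‖(u N).coeff γ - y γ‖ := by
      simpa using norm_sub_le ((u N).coeff γ) ((u N).coeff γ - y γ)
    linarith
  refine ⟨⟨y, hy0⟩, Metric.tendsto_atTop.2 fun ε hε => ?_⟩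
  obtain ⟨N, hN⟩ := hle (ε / 2) (half_pos hε)
  refine ⟨N, fun n hn => ?_⟩
  rw [dist_eq_norm]
  exact (norm_le (half_pos hε).le (hN n hn)).trans_lt (half_lt_self hε)

open Classical in
/-- The element `γ` of `c₀(Γ)`. -/
def single (γ : Γ) : C0 p Γ where
  coeff a := if a = γ then 1 else 0
  tendsto_zero := by
    refine tendsto_const_nhds.congr' ?_
    filter_upwards [(Set.finite_singleton γ).compl_mem_cofinite] with a ha
    exact (if_neg (by simpa using ha)).symm

open Classical in
theorem coeff_single (γ a : Γ) : (single γ : C0 p Γ).coeff a = if a = γ then 1 else 0 := rfl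

section Group

variable [Group Γ]

theorem tendsto_conv (x y : C0 p Γ) :
    Tendsto (fun q : Γ × Γ => x.coeff q.1 * y.coeff (q.1⁻¹ * q.2)) cofinite (𝓝 0) := by
  have h := tendsto_mul_cofinite_nhds_zero x.tendsto_zero y.tendsto_zero
  have hinj : Function.Injective fun q : Γ × Γ => (q.1, q.1⁻¹ * q.2) := by
    rintro ⟨a, b⟩ ⟨c, d⟩ h
    simp only [Prod.mk.injEq] at h ⊢
    obtain ⟨rfl, h⟩ := h
    exact ⟨rfl, mul_left_cancel h⟩
  exact h.comp hinj.tendsto_cofinite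

theorem tendsto_conv_right (x y : C0 p Γ) (γ : Γ) :
    Tendsto (fun a => x.coeff a * y.coeff (a⁻¹ * γ)) cofinite (𝓝 0) :=
  (tendsto_conv x y).comp
    (Function.Injective.tendsto_cofinite (f := fun a : Γ => (a, γ)) fun _ _ h => congrArg Prod.fst h)

theorem summable_conv (x y : C0 p Γ) (γ : Γ) :
    Summable fun a => x.coeff a * y.coeff (a⁻¹ * γ) :=
  (NonarchimedeanAddGroup.summable_iff_tendsto_cofinite_zero _).2 (tendsto_conv_right x y γ)

/-- The convolution product. -/
instance : Mul (C0 p Γ) where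
  mul x y :=
    { coeff := fun γ => ∑' a : Γ, x.coeff a * y.coeff (a⁻¹ * γ)
      tendsto_zero := by
        refine Metric.tendsto_nhds.2 fun ε hε => ?_
        have h := Metric.tendsto_nhds.1 (tendsto_conv x y) (ε / 2) (half_pos hε)
        rw [eventually_cofinite] at h ⊢
        refine (h.image Prod.snd).subset fun γ hγ => ?_
        by_contra hcon
        refine hγ ?_
        rw [dist_zero_right]
        refine (IsUltrametricDist.norm_tsum_le_of_forall_le (C := ε / 2) fun a => ?_).trans_lt
          (half_lt_self hε)
        by_contra ha
        refine hcon ⟨(a, γ), ?_, rfl⟩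
        rw [Set.mem_ofPred_eq, dist_zero_right]
        exact fun h' => ha h'.le }

theorem coeff_mul (x y : C0 p Γ) (γ : Γ) :
    (x * y).coeff γ = ∑' a : Γ, x.coeff a * y.coeff (a⁻¹ * γ) := rfl

instance : One (C0 p Γ) := ⟨single 1⟩

theorem one_def : (1 : C0 p Γ) = single 1 := rfl

theorem coeff_single_mul (g : Γ) (y : C0 p Γ) (γ : Γ) :
    (single g * y).coeff γ = y.coeff (g⁻¹ * γ) := by
  classical
  rw [coeff_mul, tsum_eq_single g]
  · simp [coeff_single]
  · intro a ha
    simp [coeff_single, ha]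

theorem coeff_mul_single (x : C0 p Γ) (g : Γ) (γ : Γ) :
    (x * single g).coeff γ = x.coeff (γ * g⁻¹) := by
  classical
  rw [coeff_mul, tsum_eq_single (γ * g⁻¹)]
  · simp [coeff_single]
  · intro a ha
    have : a⁻¹ * γ ≠ g := by
      rintro rfl
      exact ha (by simp)
    simp [coeff_single, this]

theorem single_mul_single (g h : Γ) : (single g * single h : C0 p Γ) = single (g * h) := by
  classical
  ext γ
  rw [coeff_single_mul, coeff_single, coeff_single]
  simp [inv_mul_eq_iff_eq_mul]

theorem conv_assoc (x y z : C0 p Γ) : x * y * z = x * (y * z) := by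
  ext γ
  have hs : Summable (Function.uncurry fun a b : Γ =>
      x.coeff b * y.coeff (b⁻¹ * a) * z.coeff (a⁻¹ * γ)) := by
    rw [NonarchimedeanAddGroup.summable_iff_tendsto_cofinite_zero]
    have hinj : Function.Injective fun q : Γ × Γ => (q.2, q.1⁻¹ * γ) := by
      rintro ⟨a, b⟩ ⟨c, d⟩ h
      simpa [and_comm] using h
    have h := ((tendsto_mul_cofinite_nhds_zero x.tendsto_zero z.tendsto_zero).comp
      hinj.tendsto_cofinite).norm.mul_const ‖y‖
    rw [norm_zero, zero_mul] at h
    refine squeeze_zero_norm (fun q => ?_) h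
    simp only [Function.uncurry, Function.comp, norm_mul]
    calc _ = ‖x.coeff q.2‖ * ‖z.coeff (q.1⁻¹ * γ)‖ * ‖y.coeff (q.2⁻¹ * q.1)‖ := by ring
      _ ≤ _ := by gcongr; exact norm_coeff_le _ _
  calc (x * y * z).coeff γ
      = ∑' a, ∑' b, x.coeff b * y.coeff (b⁻¹ * a) * z.coeff (a⁻¹ * γ) := by
        simp only [coeff_mul, tsum_mul_right]
    _ = ∑' b, ∑' a, x.coeff b * y.coeff (b⁻¹ * a) * z.coeff (a⁻¹ * γ) := (hs.tsum_comm).symm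
    _ = ∑' b, x.coeff b * ∑' a, y.coeff (b⁻¹ * a) * z.coeff (a⁻¹ * γ) := by
        simp only [mul_assoc, tsum_mul_left]
    _ = (x * (y * z)).coeff γ := by
        simp only [coeff_mul]
        refine tsum_congr fun b => ?_
        congr 1
        rw [← (Equiv.mulLeft b).tsum_eq]
        simp [mul_assoc]

instance : Ring (C0 p Γ) where
  __ := (inferInstance : AddCommGroup (C0 p Γ))
  left_distrib x y z := by
    ext γ
    simp only [coeff_mul, coeff_add, mul_add]
    exact (summable_conv x y γ).tsum_add (summable_conv x z γ)
  right_distrib x y z := by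
    ext γ
    simp only [coeff_mul, coeff_add, add_mul]
    exact (summable_conv x z γ).tsum_add (summable_conv y z γ)
  zero_mul x := by ext γ; simp [coeff_mul]
  mul_zero x := by ext γ; simp [coeff_mul]
  mul_assoc := conv_assoc
  one_mul x := by ext γ; simp [one_def, coeff_single_mul]
  mul_one x := by ext γ; simp [one_def, coeff_mul_single]

theorem norm_mul_le' (x y : C0 p Γ) : ‖x * y‖ ≤ ‖x‖ * ‖y‖ :=
  norm_le (mul_nonneg (norm_nonneg' _) (norm_nonneg' _)) fun γ =>
    IsUltrametricDist.norm_tsum_le_of_forall_le fun a => by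
      rw [norm_mul]
      exact mul_le_mul (norm_coeff_le _ _) (norm_coeff_le _ _) (norm_nonneg _) (norm_nonneg' _)

instance : NormedRing (C0 p Γ) where
  __ := (inferInstance : NormedAddCommGroup (C0 p Γ))
  __ := (inferInstance : Ring (C0 p Γ))
  norm_mul_le := norm_mul_le'

instance : NormedAlgebra ℚ_[p] (C0 p Γ) where
  __ := Algebra.ofModule (R := ℚ_[p]) (A := C0 p Γ)
    (fun c x y => by ext γ; simp [coeff_mul, mul_assoc, tsum_mul_left])
    (fun c x y => by ext γ; simp [coeff_mul, mul_left_comm, tsum_mul_left])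
  norm_smul_le c x := norm_le (by positivity) fun γ => by
    rw [coeff_smul, norm_mul]
    gcongr
    exact norm_coeff_le x γ

end Group

variable (p Γ) in
/-- `c₀(Γ, ℤ_p) = c₀(Γ)⁰`: the subring of all `∑ x_γ γ` in `c₀(Γ)` with all `x_γ` in `ℤ_p`. -/
def integral [Group Γ] : Subring (C0 p Γ) where
  carrier := {x | ∀ γ, x.coeff γ ∈ PadicInt.subring p}
  mul_mem' {x y} hx hy γ := IsUltrametricDist.norm_tsum_le_of_forall_le fun a => by
    rw [norm_mul]
    exact mul_le_one₀ (hx a) (norm_nonneg _) (hy _)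
  one_mem' γ := by
    classical
    rw [one_def, coeff_single]
    split_ifs
    exacts [one_mem _, zero_mem _]
  add_mem' hx hy γ := add_mem (hx γ) (hy γ)
  zero_mem' _ := zero_mem _
  neg_mem' hx γ := neg_mem (hx γ)

variable [Group Γ]

/-- The inclusion `Γ → c₀(Γ, ℤ_p)`. -/
def ofGroup : Γ →* integral p Γ where
  toFun γ := ⟨single γ, fun a => by
    classical
    rw [coeff_single]
    split_ifs
    exacts [one_mem _, zero_mem _]⟩
  map_one' := rfl
  map_mul' g h := Subtype.ext (single_mul_single g h).symm

/-- The trace `tr_Γ(∑ a_γ γ) = a_e` of `c₀(Γ)`, extended to `M_r(c₀(Γ))` by composing with the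
matrix trace. -/
def traceΓ {r : ℕ} (a : Matrix (Fin r) (Fin r) (C0 p Γ)) : ℚ_[p] :=
  (Matrix.trace a).coeff 1

/-- The logarithmic series `log u = -∑_{ν ≥ 1} (1 - u)^ν / ν` in `M_r(c₀(Γ))`. The topology on
matrices is the product topology, which is that of the norm `max_{ij} ‖a_ij‖`. -/
def logSeries {r : ℕ} (u : Matrix (Fin r) (Fin r) (C0 p Γ)) :
    Matrix (Fin r) (Fin r) (C0 p Γ) :=
  -∑' ν : ℕ, ((ν + 1 : ℕ) : ℚ_[p])⁻¹ • (1 - u) ^ (ν + 1)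

/-- The inclusion `M_r(c₀(Γ, ℤ_p)) → M_r(c₀(Γ))`. -/
def matrixIncl (r : ℕ) :
    Matrix (Fin r) (Fin r) (integral p Γ) →+* Matrix (Fin r) (Fin r) (C0 p Γ) :=
  (integral p Γ).subtype.mapMatrix

variable (p Γ) in
/-- The `1`-units `1 + p M_r(c₀(Γ, ℤ_p))`. -/
def oneUnits (r : ℕ) : Set (Matrix (Fin r) (Fin r) (integral p Γ)) :=
  {u | ∃ a : Matrix (Fin r) (Fin r) (integral p Γ), u = 1 + p • a}

theorem norm_integral_le (x : integral p Γ) : ‖(x : C0 p Γ)‖ ≤ 1 := norm_le zero_le_one x.2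

theorem inv_natCast_norm_le (n : ℕ) : ‖((n + 1 : ℕ) : ℚ_[p])⁻¹‖ ≤ n + 1 := by
  have hn : n + 1 ≠ 0 := by omega
  have hp : (0 : ℝ) < p := by exact_mod_cast (Fact.out : p.Prime).pos
  rw [norm_inv, Padic.norm_eq_zpow_neg_valuation (by exact_mod_cast hn), Padic.valuation_natCast,
    zpow_neg, inv_inv, zpow_natCast]
  exact_mod_cast Nat.le_of_dvd (by omega) (pow_padicValNat_dvd (p := p) (n := n + 1))

theorem norm_pow_entry_le {r : ℕ} (a : Matrix (Fin r) (Fin r) (integral p Γ)) (n : ℕ)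
    (i j : Fin r) : ‖((matrixIncl r (p • a)) ^ n) i j‖ ≤ ((p : ℝ)⁻¹) ^ n := by
  have h : (matrixIncl r (p • a)) ^ n = ((p : ℚ_[p]) ^ n) • matrixIncl r (a ^ n) := by
    rw [map_nsmul, ← Nat.cast_smul_eq_nsmul ℚ_[p], smul_pow, map_pow]
  rw [h, Matrix.smul_apply]
  refine (norm_smul_le _ _).trans ?_
  rw [norm_pow, Padic.norm_p]
  exact mul_le_of_le_one_right (by positivity) (norm_integral_le _)

/-- The logarithmic series converges on `1`-units. -/
theorem summable_logSeries {r : ℕ} {u : Matrix (Fin r) (Fin r) (integral p Γ)}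
    (hu : u ∈ oneUnits p Γ r) :
    Summable fun ν : ℕ => ((ν + 1 : ℕ) : ℚ_[p])⁻¹ • (1 - matrixIncl r u) ^ (ν + 1) := by
  obtain ⟨a, rfl⟩ := hu
  have h1 : 1 - matrixIncl r (1 + p • a) = matrixIncl r (p • (-a)) := by
    rw [map_add, map_one, smul_neg, map_neg]; abel
  rw [h1]
  refine Pi.summable.2 fun i => Pi.summable.2 fun j => ?_
  rw [NonarchimedeanAddGroup.summable_iff_tendsto_cofinite_zero, Nat.cofinite_eq_atTop]
  have hp : (1 : ℝ) < p := by exact_mod_cast (Fact.out : p.Prime).one_lt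
  have ht : Tendsto (fun n : ℕ => ((n + 1 : ℕ) : ℝ) * ((p : ℝ)⁻¹) ^ (n + 1)) atTop (𝓝 0) :=
    (tendsto_add_atTop_iff_nat (f := fun n : ℕ => (n : ℝ) * ((p : ℝ)⁻¹) ^ n) 1).2
      (tendsto_self_mul_const_pow_of_lt_one (by positivity) (inv_lt_one_of_one_lt₀ hp))
  refine squeeze_zero_norm (fun n => ?_) ht
  rw [Matrix.smul_apply]
  refine (norm_smul_le _ _).trans ?_
  refine mul_le_mul ((inv_natCast_norm_le n).trans_eq (by push_cast; rfl))
    (norm_pow_entry_le _ _ _ _) (norm_nonneg _) (by positivity)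

/-- The `1`-units are invertible: `1 + p M_r(c₀(Γ, ℤ_p)) ⊆ GL_r(c₀(Γ, ℤ_p))`. -/
theorem isUnit_of_mem_oneUnits {r : ℕ} {u : Matrix (Fin r) (Fin r) (integral p Γ)}
    (hu : u ∈ oneUnits p Γ r) : IsUnit u := by
  obtain ⟨a, rfl⟩ := hu
  set x := matrixIncl r (p • (-a)) with hx
  have hp : (1 : ℝ) < p := by exact_mod_cast (Fact.out : p.Prime).one_lt
  have hent : ∀ i j, Summable fun n : ℕ => (x ^ n) i j := fun i j => by
    rw [NonarchimedeanAddGroup.summable_iff_tendsto_cofinite_zero, Nat.cofinite_eq_atTop]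
    exact squeeze_zero_norm (fun n => norm_pow_entry_le _ _ _ _)
      (tendsto_pow_atTop_nhds_zero_of_lt_one (by positivity) (inv_lt_one_of_one_lt₀ hp))
  have hs : Summable (x ^ ·) := Pi.summable.2 fun i => Pi.summable.2 fun j => hent i j
  have happ : ∀ i j, (∑' n, x ^ n) i j = ∑' n, (x ^ n) i j := fun i j => by
    have := Pi.hasSum.1 (Pi.hasSum.1 hs.hasSum i) j
    exact this.tsum_eq.symm
  have hmem : ∀ i j, (∑' n, x ^ n) i j ∈ integral p Γ := fun i j γ => by
    rw [happ]
    refine (norm_coeff_le _ γ).trans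
      (IsUltrametricDist.norm_tsum_le_of_forall_le fun n => (norm_pow_entry_le _ _ _ _).trans ?_)
    exact pow_le_one₀ (by positivity) (inv_le_one_of_one_le₀ hp.le)
  let b : Matrix (Fin r) (Fin r) (integral p Γ) := fun i j => ⟨_, hmem i j⟩
  have hb : matrixIncl r b = ∑' n, x ^ n := rfl
  have hinj : Function.Injective (matrixIncl r : _ → Matrix (Fin r) (Fin r) (C0 p Γ)) :=
    fun a b h => by
      ext i j : 1
      exact Subtype.ext (congrFun (congrFun h i) j)
  have h1 : matrixIncl r (1 + p • a) = 1 - x := by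
    rw [hx, map_add, map_one, smul_neg, map_neg]; abel
  refine ⟨⟨1 + p • a, b, hinj ?_, hinj ?_⟩, rfl⟩
  · rw [map_mul, h1, hb, map_one, hs.one_sub_mul_tsum_pow]
  · rw [map_mul, h1, hb, map_one, hs.tsum_pow_mul_one_sub]

/-- The inclusion `1 + p M_r(c₀(Γ, ℤ_p)) ↪ GL_r(c₀(Γ, ℤ_p))`. -/
def oneUnitsToGL (r : ℕ) (u : oneUnits p Γ r) :
    Matrix.GeneralLinearGroup (Fin r) (integral p Γ) :=
  (isUnit_of_mem_oneUnits u.2).unit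

/-- The map `log_p det_Γ = tr_Γ log` on the `1`-units `1 + p M_r(c₀(Γ, ℤ_p))`. -/
def logDetOneUnits (r : ℕ) (u : oneUnits p Γ r) : ℚ_[p] :=
  traceΓ (logSeries (matrixIncl r (u : Matrix (Fin r) (Fin r) (integral p Γ))))

end

end C0

/-! On `1`-units `tr_Γ ∘ log` is not visibly multiplicative, since `log` is not additive on
non-commuting matrices. The remedy is to read it off from ordinary determinants in finite quotients.
For a normal subgroup `N` of finite index, `c₀(Γ, ℤ_p)` acts on the permutation module of `Γ ⧸ N`,
which gives a homomorphism `K1.det` from `K₁` to `ℚ_p^×`.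

For a `1`-unit `u` put `Q_n = (u ^ (p ^ n) - 1) / p ^ n`. These matrices have entries of norm at
most `1` and tend to `log u`. Hence `det(u) ^ (p ^ n) = det(1 + p ^ n Q_n) = 1 + p ^ n tr Q_n + O(p
^ (2n))` in each quotient, so the logarithm of the determinant is the trace of the image of `log u`
(`isPadicLog_det_oneUnitsToGL`). Group elements have determinants of finite order, so their
logarithm is `0`.

Conversely, these traces determine `tr_Γ`: divided by the index, the trace of `b` in `Γ ⧸ N` is the
sum of the `b_γ` over `γ ∈ N`. Residual finiteness lets `N` avoid the finitely many large
coefficients other than `b_1`, so the ultrametric inequality isolates `b_1` (`coeff_one_eq_zero`).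
The relation `IsLogDet` is therefore single-valued and multiplicative.

Existence and uniqueness both come from the torsion hypothesis. Reduction modulo `p` maps `c₀(Γ,
ℤ_p)` onto `𝔽_p[Γ]`, and elementary matrices lift, so every class `x` in `K₁` satisfies `x ^ n =
[u][γ]` for some `n ≠ 0`, a `1`-unit `u` and `γ ∈ Γ` (`exists_pow_eq_oneUnit_mul_groupClass`). The
value at `x` must then be `tr_Γ(log u) / n`. -/

/-! ### Homomorphisms out of `K₁` -/

namespace K1

variable {R : Type*} [Ring R]

/-- A compatible family of homomorphisms `GL_n(R) → H` that kill the elementary matrices induces a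
homomorphism `K₁(R) → H`. -/
noncomputable def lift {H : Type*} [Group H]
    (f : ∀ n : ℕ, Matrix.GeneralLinearGroup (Fin n) R →* H)
    (hf : ∀ (m n : ℕ) (h : m ≤ n) (a : Matrix.GeneralLinearGroup (Fin m) R),
      f m a = f n (stabGL h a))
    (he : ∀ n, elementaryGroup R (Fin n) ≤ (f n).ker) : K1 R →* H :=
  QuotientGroup.lift (EInf R)
    { toFun := DirectLimit.lift (fun _ _ h => (stabGL h : _ →* _)) (fun n => (f n : _ → H)) hf
      map_one' := DirectLimit.lift_one f hf
      map_mul' := DirectLimit.lift_mul f hf }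
    (by
      refine iSup_le fun n => ?_
      rintro _ ⟨g, hg, rfl⟩
      exact he n hg)

theorem ofGL_stab {m n : ℕ} (h : m ≤ n) (a : Matrix.GeneralLinearGroup (Fin m) R) :
    ofGL R n (stabGL h a) = ofGL R m a :=
  congrArg (QuotientGroup.mk' (EInf R)) (GLInf.of_stab R h a)

theorem ofGL_eq_one_of_mem {n : ℕ} {g : Matrix.GeneralLinearGroup (Fin n) R}
    (hg : g ∈ elementaryGroup R (Fin n)) : ofGL R n g = 1 :=
  (QuotientGroup.eq_one_iff _).2 (Subgroup.mem_iSup_of_mem n ⟨g, hg, rfl⟩)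

theorem exists_ofGL (x : K1 R) : ∃ n g, x = ofGL R n g := by
  obtain ⟨y, rfl⟩ := QuotientGroup.mk'_surjective (EInf R) x
  obtain ⟨n, g, rfl⟩ := DirectLimit.exists_eq_mk _ y
  exact ⟨n, g, rfl⟩

theorem stabGL_mem {m n : ℕ} (h : m ≤ n) {g : Matrix.GeneralLinearGroup (Fin m) R}
    (hg : g ∈ elementaryGroup R (Fin m)) : stabGL h g ∈ elementaryGroup R (Fin n) := by
  suffices elementaryGroup R (Fin m) ≤ (elementaryGroup R (Fin n)).comap (stabGL h) from this hg
  refine (Subgroup.closure_le _).2 ?_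
  rintro g ⟨i, j, c, hij, hg⟩
  refine Subgroup.subset_closure ⟨Fin.castLE h i, Fin.castLE h j, c, by simpa using hij, ?_⟩
  ext a b
  simp only [stabGL, Units.coe_map, MonoidHom.coe_mk, OneHom.coe_mk, stabMatrix, hg,
    Matrix.add_apply, Matrix.one_apply, Matrix.single_apply, Fin.ext_iff, Fin.val_castLE]
  split_ifs <;> first | (exfalso; omega) | simp

/-- Stabilization preserves elementary matrices, so the images are nested and their supremum is
their union. -/
theorem mem_EInf_iff {x : GLInf R} :
    x ∈ EInf R ↔ ∃ n, ∃ g ∈ elementaryGroup R (Fin n), GLInf.of R n g = x := by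
  rw [EInf, Subgroup.mem_iSup_of_directed]
  · rfl
  · refine Monotone.directed_le fun m n h => ?_
    rintro _ ⟨g, hg, rfl⟩
    exact ⟨stabGL h g, stabGL_mem h hg, GLInf.of_stab R h g⟩

/-- An invertible matrix is trivial in `K₁` only if it is stably elementary. -/
theorem exists_stabGL_mem_of_ofGL_eq_one {m : ℕ} {a : Matrix.GeneralLinearGroup (Fin m) R}
    (ha : ofGL R m a = 1) (k : ℕ) :
    ∃ n, k ≤ n ∧ ∃ h : m ≤ n, stabGL h a ∈ elementaryGroup R (Fin n) := by
  obtain ⟨l, g, hg, h⟩ := mem_EInf_iff.1 ((QuotientGroup.eq_one_iff _).1 ha)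
  obtain ⟨n, h1, h2, h3⟩ := Quotient.exact h
  -- The two matrices agree at stage `n`; stabilizing once more makes the size at least `k`.
  refine ⟨max n k, le_max_right _ _, h2.trans (le_max_left _ _), ?_⟩
  have h4 : stabGL h1 g = stabGL h2 a := h3
  have h5 := stabGL_mem (le_max_left n k) (h4 ▸ stabGL_mem h1 hg)
  rwa [show stabGL (le_max_left n k) (stabGL h2 a) = stabGL (h2.trans (le_max_left _ _)) a from
    DirectedSystem.map_map' (F := fun n : ℕ => Matrix.GeneralLinearGroup (Fin n) R)
      (fun _ _ h => (stabGL h : _ →* _)) _ _ a] at h5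

/-! ### Determinants of matrix representations -/

section Det

variable {k G : Type*} [CommRing k] [Fintype G] [DecidableEq G] (ρ : R →+* Matrix G G k)

/-- The matrix over `k` obtained by applying a matrix representation to all entries. -/
def blockMatrix (ι : Type*) [Fintype ι] [DecidableEq ι] :
    Matrix ι ι R →+* Matrix (ι × G) (ι × G) k :=
  ((Matrix.compRingEquiv ι G k : Matrix ι ι (Matrix G G k) ≃+* _) :
    Matrix ι ι (Matrix G G k) →+* _).comp ρ.mapMatrix

theorem blockMatrix_apply {ι : Type*} [Fintype ι] [DecidableEq ι] (a : Matrix ι ι R)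
    (x y : ι × G) : blockMatrix ρ ι a x y = ρ (a x.1 y.1) x.2 y.2 := rfl

/-- The determinant of the image of an invertible matrix under a matrix representation. -/
def detGL (ι : Type*) [Fintype ι] [DecidableEq ι] : Matrix.GeneralLinearGroup ι R →* kˣ :=
  Units.map (Matrix.detMonoidHom.comp (blockMatrix ρ ι).toMonoidHom)

theorem coe_detGL {ι : Type*} [Fintype ι] [DecidableEq ι]
    (a : Matrix.GeneralLinearGroup ι R) :
    (detGL ρ ι a : k) = (blockMatrix ρ ι a).det := rfl

/-- As `i ≠ j`, products of two matrices supported at `(i, j)` vanish, so `1 + e_ij(M)` is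
multiplicative in `M`. This reduces the block transvection to transvections over `k`. -/
theorem det_blockMatrix_one_add_single {ι : Type*} [Fintype ι] [DecidableEq ι] {i j : ι}
    (hij : i ≠ j) (c : R) : (blockMatrix ρ ι (1 + Matrix.single i j c)).det = 1 := by
  have h : ∀ M : Matrix G G k,
      (1 + (Matrix.compRingEquiv ι G k) (Matrix.single i j M)).det = 1 := by
    intro M
    induction M using Matrix.induction_on' with
    | h_zero => rw [Matrix.single_zero, map_zero, add_zero, Matrix.det_one]
    | h_add A B hA hB =>
      have : 1 + (Matrix.compRingEquiv ι G k) (Matrix.single i j (A + B)) =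
          (1 + (Matrix.compRingEquiv ι G k) (Matrix.single i j A)) *
            (1 + (Matrix.compRingEquiv ι G k) (Matrix.single i j B)) := by
        rw [Matrix.single_add, map_add, mul_add, add_mul, add_mul, ← map_mul,
          Matrix.single_mul_single_of_ne _ _ _ _ hij.symm]
        rw [map_zero, add_zero, one_mul, mul_one, one_mul, add_assoc]
      rw [this, Matrix.det_mul, hA, hB, one_mul]
    | h_std_basis g h x =>
      have : (Matrix.compRingEquiv ι G k) (Matrix.single i j (Matrix.single g h x)) =
          Matrix.single (i, g) (j, h) x := by
        ext a b
        simp only [Matrix.compRingEquiv_apply, Matrix.comp_apply, Matrix.single_apply,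
          Prod.ext_iff]
        split_ifs <;> simp_all
      rw [this]
      exact Matrix.det_transvection_of_ne (i, g) (j, h) (fun h => hij (congrArg Prod.fst h)) x
  have h1 : ρ.mapMatrix (Matrix.single i j c) = Matrix.single i j (ρ c) := by
    ext a b : 2
    simp only [RingHom.mapMatrix_apply, Matrix.map_apply, Matrix.single_apply]
    split_ifs <;> simp
  rw [map_add, map_one, ← h (ρ c), ← h1]
  rfl

theorem elementaryGroup_le_ker_detGL (ι : Type*) [Fintype ι] [DecidableEq ι] :
    elementaryGroup R ι ≤ (detGL ρ ι).ker := by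
  refine (Subgroup.closure_le _).2 ?_
  rintro g ⟨i, j, c, hij, hg⟩
  refine Units.ext ?_
  rw [coe_detGL, hg, det_blockMatrix_one_add_single ρ hij, Units.val_one]

/-- The stabilized matrix is block triangular, with an identity block on the new indices. -/
theorem detGL_stabGL {m n : ℕ} (h : m ≤ n) (a : Matrix.GeneralLinearGroup (Fin m) R) :
    detGL ρ (Fin n) (stabGL h a) = detGL ρ (Fin m) a := by
  refine Units.ext ?_
  rw [coe_detGL, coe_detGL]
  have hs : ((stabGL h a : Matrix.GeneralLinearGroup (Fin n) R) : Matrix (Fin n) (Fin n) R) =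
    stabMatrix a.val := rfl
  rw [hs, Matrix.twoBlockTriangular_det _ (fun x : Fin n × G => x.1.1 < m)]
  · have h2 : Matrix.toSquareBlockProp (blockMatrix ρ (Fin n) (stabMatrix a.val))
        (fun x => ¬ x.1.1 < m) = 1 := by
      ext ⟨⟨i, g⟩, hi⟩ ⟨⟨j, g'⟩, hj⟩
      simp only [Matrix.toSquareBlockProp_def, Matrix.of_apply, blockMatrix_apply, stabMatrix]
      have hi' : ¬ i.1 < m := hi
      rw [dif_neg (by tauto)]
      by_cases hij : i = j
      · subst hij
        simp [Matrix.one_apply]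
      · simp [hij]
    let e : Fin m × G ≃ {x : Fin n × G // x.1.1 < m} :=
      { toFun := fun x => ⟨(Fin.castLE h x.1, x.2), x.1.2⟩
        invFun := fun x => (⟨x.1.1.1, x.2⟩, x.1.2)
        left_inv := fun _ => rfl
        right_inv := fun _ => rfl }
    rw [h2, Matrix.det_one, mul_one, ← Matrix.det_submatrix_equiv_self e]
    congr 1
    ext ⟨i, g⟩ ⟨j, g'⟩
    simp [e, Matrix.toSquareBlockProp_def, blockMatrix_apply, stabMatrix]
  · rintro ⟨i, g⟩ hi ⟨j, g'⟩ hj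
    have hi' : ¬ i.1 < m := hi
    have hij : i ≠ j := by rintro rfl; exact hi hj
    simp [blockMatrix_apply, stabMatrix, hi', hij]

/-- The determinant `K₁(R) → kˣ` attached to a matrix representation of `R` over `k`. -/
noncomputable def det : K1 R →* kˣ :=
  lift (fun n => detGL ρ (Fin n)) (fun _ _ h a => (detGL_stabGL ρ h a).symm)
    (fun _ => elementaryGroup_le_ker_detGL ρ _)

theorem det_ofGL (n : ℕ) (a : Matrix.GeneralLinearGroup (Fin n) R) :
    (det ρ (ofGL R n a) : k) = (blockMatrix ρ (Fin n) a).det := rfl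

theorem det_ofUnits (a : Rˣ) : (det ρ (ofUnits R a) : k) = (ρ a).det := by
  rw [ofUnits, MonoidHom.comp_apply, det_ofGL,
    ← Matrix.det_submatrix_equiv_self (Equiv.uniqueProd G (Fin 1)).symm]
  congr 1

end Det

end K1

/-! ### The `p`-adic logarithm as a limit -/

section PadicLog

variable {p : ℕ} [Fact p.Prime]

theorem Padic.tendsto_natCast_pow_zero : Tendsto (fun n : ℕ => (p : ℚ_[p]) ^ n) atTop (𝓝 0) :=
  tendsto_pow_atTop_nhds_zero_of_norm_lt_one Padic.norm_p_lt_one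

theorem Padic.natCast_pow_ne_zero (n : ℕ) : (p : ℚ_[p]) ^ n ≠ 0 :=
  pow_ne_zero _ (by exact_mod_cast (Fact.out : p.Prime).ne_zero)

theorem Padic.choose_pow_eq (n k : ℕ) :
    ((p ^ n).choose (k + 1) : ℚ_[p]) =
      (p : ℚ_[p]) ^ n * (((p ^ n - 1).choose k : ℚ_[p]) * ((k + 1 : ℕ) : ℚ_[p])⁻¹) := by
  have h := Nat.add_one_mul_choose_eq (p ^ n - 1) k
  rw [Nat.sub_add_cancel (Nat.pos_of_ne_zero (pow_ne_zero _ (Fact.out : p.Prime).ne_zero))] at h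
  have h' : (p : ℚ_[p]) ^ n * ((p ^ n - 1).choose k : ℚ_[p]) =
      ((p ^ n).choose (k + 1) : ℚ_[p]) * ((k + 1 : ℕ) : ℚ_[p]) := by exact_mod_cast h
  have hk : ((k + 1 : ℕ) : ℚ_[p]) ≠ 0 := by exact_mod_cast k.succ_ne_zero
  rw [← mul_assoc, h', mul_inv_cancel_right₀ hk]

/-- By Pascal's rule the `(k+1)`-st coefficient is `(p ^ n).choose (k + 1)` minus the `k`-th. The
former tends to `0` because of its factor `p ^ n`. -/
theorem Padic.tendsto_choose_pow_sub_one (k : ℕ) :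
    Tendsto (fun n : ℕ => ((p ^ n - 1).choose k : ℚ_[p])) atTop (𝓝 ((-1) ^ k)) := by
  induction k with
  | zero => simp
  | succ k ih =>
    have h1 : Tendsto (fun n : ℕ => ((p ^ n).choose (k + 1) : ℚ_[p])) atTop (𝓝 0) := by
      simp_rw [Padic.choose_pow_eq]
      simpa using Padic.tendsto_natCast_pow_zero.mul (ih.mul_const ((k + 1 : ℕ) : ℚ_[p])⁻¹)
    have h2 := h1.sub ih
    rw [zero_sub, ← neg_one_mul, ← pow_succ'] at h2
    refine h2.congr fun n => ?_
    have h := Nat.choose_succ_succ (p ^ n - 1) k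
    rw [Nat.succ_eq_add_one, Nat.sub_add_cancel
      (Nat.pos_of_ne_zero (pow_ne_zero _ (Fact.out : p.Prime).ne_zero))] at h
    rw [h]
    push_cast
    ring

/-- `c` is a `p`-adic logarithm of `z`: for some `k ≥ 1`, the quotients `(z ^ (k p ^ n) - 1) / p ^ n`
converge to `k c`. -/
def IsPadicLog (z c : ℚ_[p]) : Prop :=
  ∃ k : ℕ, k ≠ 0 ∧
    Tendsto (fun n : ℕ => (z ^ (k * p ^ n) - 1) / (p : ℚ_[p]) ^ n) atTop (𝓝 (k * c))

/-- With `Z = z ^ p ^ n` and `W = w ^ p ^ n`, one has `ZW - 1 = (Z - 1) + (W - 1) + (Z - 1)(W - 1)`.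
After division by `p ^ n` the cross term is `p ^ n` times a convergent sequence. -/
theorem tendsto_pow_mul_sub_one_div {z c : ℚ_[p]} {w d : ℚ_[p]}
    (hz : Tendsto (fun n : ℕ => (z ^ p ^ n - 1) / (p : ℚ_[p]) ^ n) atTop (𝓝 c))
    (hw : Tendsto (fun n : ℕ => (w ^ p ^ n - 1) / (p : ℚ_[p]) ^ n) atTop (𝓝 d)) :
    Tendsto (fun n : ℕ => ((z * w) ^ p ^ n - 1) / (p : ℚ_[p]) ^ n) atTop (𝓝 (c + d)) := by
  have h1 := (hz.mul hw).mul (Padic.tendsto_natCast_pow_zero (p := p))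
  have h2 := (hz.add hw).add h1
  rw [mul_zero, add_zero] at h2
  refine h2.congr fun n => ?_
  have := Padic.natCast_pow_ne_zero (p := p) n
  field_simp
  ring

theorem tendsto_pow_sub_one_div_pow {z c : ℚ_[p]}
    (hz : Tendsto (fun n : ℕ => (z ^ p ^ n - 1) / (p : ℚ_[p]) ^ n) atTop (𝓝 c)) (m : ℕ) :
    Tendsto (fun n : ℕ => ((z ^ m) ^ p ^ n - 1) / (p : ℚ_[p]) ^ n) atTop (𝓝 (m * c)) := by
  induction m with
  | zero => simp
  | succ m ih =>
    have h := tendsto_pow_mul_sub_one_div ih hz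
    simpa only [pow_succ, Nat.cast_succ, add_mul, one_mul] using h

namespace IsPadicLog

theorem of_tendsto {z c : ℚ_[p]}
    (hz : Tendsto (fun n : ℕ => (z ^ p ^ n - 1) / (p : ℚ_[p]) ^ n) atTop (𝓝 c)) :
    IsPadicLog z c :=
  ⟨1, one_ne_zero, by simpa using hz⟩

theorem mul {z c w d : ℚ_[p]} (hz : IsPadicLog z c) (hw : IsPadicLog w d) :
    IsPadicLog (z * w) (c + d) := by
  obtain ⟨k, hk, hz⟩ := hz
  obtain ⟨l, hl, hw⟩ := hw
  refine ⟨k * l, mul_ne_zero hk hl, ?_⟩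
  simp_rw [pow_mul] at hz hw
  have h := tendsto_pow_mul_sub_one_div (tendsto_pow_sub_one_div_pow hz l)
    (tendsto_pow_sub_one_div_pow hw k)
  have e1 : (z ^ k) ^ l * (w ^ l) ^ k = (z * w) ^ (k * l) := by
    rw [mul_pow, ← pow_mul, ← pow_mul, mul_comm l k]
  have e2 : (l : ℚ_[p]) * (k * c) + k * (l * d) = ((k * l : ℕ) : ℚ_[p]) * (c + d) := by
    push_cast; ring
  rw [e1, e2] at h
  simpa only [pow_mul] using h

theorem unique {z c d : ℚ_[p]} (hc : IsPadicLog z c) (hd : IsPadicLog z d) : c = d := by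
  obtain ⟨k, hk, hc⟩ := hc
  obtain ⟨l, hl, hd⟩ := hd
  simp_rw [pow_mul] at hc hd
  have h1 := tendsto_pow_sub_one_div_pow hc l
  have h2 := tendsto_pow_sub_one_div_pow hd k
  simp_rw [← pow_mul] at h1 h2
  rw [mul_comm l k] at h2
  have h := tendsto_nhds_unique h1 h2
  have hk' : (k : ℚ_[p]) ≠ 0 := by exact_mod_cast hk
  have hl' : (l : ℚ_[p]) ≠ 0 := by exact_mod_cast hl
  exact mul_left_cancel₀ (mul_ne_zero hk' hl') (by linear_combination h)

/-- The free exponent `k` in `IsPadicLog` absorbs `m`. This is what makes logarithms available for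
elements only a power of which is close to `1`. -/
theorem of_pow {z c : ℚ_[p]} {m : ℕ} (hm : m ≠ 0) (h : IsPadicLog (z ^ m) (m * c)) :
    IsPadicLog z c := by
  obtain ⟨k, hk, h⟩ := h
  refine ⟨m * k, mul_ne_zero hm hk, ?_⟩
  have e : ((m * k : ℕ) : ℚ_[p]) * c = k * (m * c) := by push_cast; ring
  rw [e]
  simpa only [pow_mul] using h

theorem zero_of_pow_eq_one {z : ℚ_[p]} {m : ℕ} (hm : m ≠ 0) (h : z ^ m = 1) :
    IsPadicLog z 0 :=
  ⟨m, hm, by simp [pow_mul, h]⟩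

end IsPadicLog

/-! ### Determinants of matrices close to the identity -/

/-- Over `ℤ_p` the remainder of `det(1 + qM)` after the linear term is `q ^ 2` times an integral
element. -/
theorem Padic.norm_det_one_add_smul_sub_le {n : Type*} [Fintype n] [DecidableEq n]
    {M : Matrix n n ℚ_[p]} (hM : ∀ i j, ‖M i j‖ ≤ 1) {q : ℚ_[p]} (hq : ‖q‖ ≤ 1) :
    ‖(1 + q • M).det - 1 - q * M.trace‖ ≤ ‖q‖ ^ 2 := by
  let M' : Matrix n n ℤ_[p] := fun i j => ⟨M i j, hM i j⟩
  let q' : ℤ_[p] := ⟨q, hq⟩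
  have h := congrArg (PadicInt.Coe.ringHom (p := p)) (Matrix.det_one_add_smul q' M')
  have e1 : PadicInt.Coe.ringHom (Matrix.det (1 + q' • M')) = (1 + q • M).det := by
    rw [RingHom.map_det, map_add, map_one]
    congr 2
  have e2 : PadicInt.Coe.ringHom (Matrix.trace M') = M.trace := by
    rw [Matrix.trace, map_sum]; rfl
  have e3 : PadicInt.Coe.ringHom q' = q := rfl
  rw [e1, map_add, map_add, map_mul, map_mul, map_pow, map_one, e2, e3] at h
  rw [h, add_assoc, add_sub_cancel_left, mul_comm, add_sub_cancel_left, norm_mul, norm_pow]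
  exact mul_le_of_le_one_left (by positivity) (PadicInt.norm_le_one _)

theorem Padic.tendsto_det_sub_one_div {n : Type*} [Fintype n] [DecidableEq n]
    {M : ℕ → Matrix n n ℚ_[p]} {L : Matrix n n ℚ_[p]} (hM : ∀ m i j, ‖M m i j‖ ≤ 1)
    (hL : ∀ i, Tendsto (fun m => M m i i) atTop (𝓝 (L i i))) :
    Tendsto (fun m : ℕ => ((1 + (p : ℚ_[p]) ^ m • M m).det - 1) / (p : ℚ_[p]) ^ m) atTop
      (𝓝 L.trace) := by
  have h1 : Tendsto (fun m => (M m).trace) atTop (𝓝 L.trace) :=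
    tendsto_finsetSum _ fun i _ => hL i
  have h2 : Tendsto (fun m : ℕ => ((1 + (p : ℚ_[p]) ^ m • M m).det - 1) / (p : ℚ_[p]) ^ m -
      (M m).trace) atTop (𝓝 0) := by
    have h0 := (Padic.tendsto_natCast_pow_zero (p := p)).norm
    rw [norm_zero] at h0
    refine squeeze_zero_norm (fun m => ?_) h0
    have hq := Padic.natCast_pow_ne_zero (p := p) m
    have hq1 : ‖(p : ℚ_[p]) ^ m‖ ≤ 1 := by
      rw [norm_pow]
      exact pow_le_one₀ (norm_nonneg _) Padic.norm_p_lt_one.le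
    have h := Padic.norm_det_one_add_smul_sub_le (hM m) hq1
    rw [div_sub' hq, norm_div, div_le_iff₀ (norm_pos_iff.2 hq), ← sq]
    exact h
  simpa using h2.add h1

end PadicLog

/-! ### The logarithm of a `1`-unit as a limit of difference quotients -/

namespace C0

variable {p : ℕ} [Fact p.Prime] {Γ : Type*} [Group Γ]

/-- The difference quotient `(u ^ (p ^ n) - 1) / p ^ n`, whose limit is `log u`. -/
noncomputable def logQuotient {r : ℕ} (u : Matrix (Fin r) (Fin r) (C0 p Γ)) (n : ℕ) :
    Matrix (Fin r) (Fin r) (C0 p Γ) :=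
  ((p : ℚ_[p]) ^ n)⁻¹ • (u ^ p ^ n - 1)

theorem logQuotient_one_sub {r : ℕ} (X : Matrix (Fin r) (Fin r) (C0 p Γ)) (n : ℕ) :
    logQuotient (1 - X) n = ∑ k ∈ Finset.range (p ^ n),
      (((p ^ n - 1).choose k : ℚ_[p]) * ((k + 1 : ℕ) : ℚ_[p])⁻¹) • (-X) ^ (k + 1) := by
  rw [logQuotient, sub_eq_neg_add 1 X, (Commute.one_right (-X)).add_pow, Finset.sum_range_succ']
  simp only [one_pow, mul_one, pow_zero, Nat.choose_zero_right, Nat.cast_one, add_sub_cancel_right,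
    Finset.smul_sum]
  refine Finset.sum_congr rfl fun k _ => ?_
  rw [← nsmul_eq_mul', ← Nat.cast_smul_eq_nsmul ℚ_[p], smul_smul, Padic.choose_pow_eq,
    inv_mul_cancel_left₀ (Padic.natCast_pow_ne_zero n)]

section OneUnit

variable {r : ℕ} (a : Matrix (Fin r) (Fin r) (integral p Γ))

theorem matrixIncl_one_add :
    matrixIncl r (1 + p • a) = 1 - -matrixIncl r (p • a) := by
  rw [map_add, map_one, sub_neg_eq_add]

/-- The bound is independent of `n` and summable in `k`, so it serves as the dominating sequence for
the limit in `n`. -/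
theorem norm_logTerm_le (n k : ℕ) (i j : Fin r) :
    ‖((((p ^ n - 1).choose k : ℚ_[p]) * ((k + 1 : ℕ) : ℚ_[p])⁻¹) •
      matrixIncl r (p • a) ^ (k + 1)) i j‖ ≤ ((k + 1 : ℕ) : ℝ) * ((p : ℝ)⁻¹) ^ (k + 1) := by
  rw [Matrix.smul_apply]
  refine (norm_smul_le _ _).trans (mul_le_mul ?_ (norm_pow_entry_le _ _ _ _) (norm_nonneg _)
    (by positivity))
  rw [norm_mul]
  refine (mul_le_of_le_one_left (norm_nonneg _) ?_).trans
    ((inv_natCast_norm_le k).trans_eq (by push_cast; rfl))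
  exact_mod_cast Padic.norm_int_le_one (p := p) ((p ^ n - 1).choose k : ℤ)

/-- Each term is bounded by `(k + 1) / p ^ (k + 1) ≤ 1`. This integrality is what controls the
quadratic remainder of the determinant. -/
theorem norm_logQuotient_le (n : ℕ) (i j : Fin r) :
    ‖logQuotient (matrixIncl r (1 + p • a)) n i j‖ ≤ 1 := by
  rw [matrixIncl_one_add, logQuotient_one_sub, Matrix.sum_apply]
  refine IsUltrametricDist.norm_sum_le_of_forall_le_of_nonneg zero_le_one fun k _ => ?_
  rw [neg_neg]
  refine (norm_logTerm_le a n k i j).trans ?_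
  have hp : 0 < p := (Fact.out : p.Prime).pos
  rw [inv_pow, ← div_eq_mul_inv, div_le_one (by positivity)]
  exact_mod_cast (Nat.lt_pow_self (Fact.out : p.Prime).one_lt).le

/-- Dominated convergence in the binomial expansion: `(p ^ n - 1).choose k / (k + 1)` tends to `(-1)
^ k / (k + 1)`, the coefficient of the logarithm. -/
theorem tendsto_logQuotient (i j : Fin r) :
    Tendsto (fun n => logQuotient (matrixIncl r (1 + p • a)) n i j) atTop
      (𝓝 (logSeries (matrixIncl r (1 + p • a)) i j)) := by
  have hsum : Summable fun k : ℕ => ((k + 1 : ℕ) : ℝ) * ((p : ℝ)⁻¹) ^ (k + 1) := by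
    have hp : (1 : ℝ) < p := by exact_mod_cast (Fact.out : p.Prime).one_lt
    refine (summable_nat_add_iff (f := fun k : ℕ => (k : ℝ) * ((p : ℝ)⁻¹) ^ k) 1).2 ?_
    have h := summable_pow_mul_geometric_of_norm_lt_one (R := ℝ) 1 (r := (p : ℝ)⁻¹)
      (by rw [norm_inv, Real.norm_natCast]; exact inv_lt_one_of_one_lt₀ hp)
    simpa using h
  have hlim := tendsto_tsum_of_dominated_convergence (𝓕 := atTop) hsum
    (f := fun (n k : ℕ) => ((((p ^ n - 1).choose k : ℚ_[p]) * ((k + 1 : ℕ) : ℚ_[p])⁻¹) •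
      matrixIncl r (p • a) ^ (k + 1)) i j)
    (g := fun k => (((-1) ^ k * ((k + 1 : ℕ) : ℚ_[p])⁻¹) •
      matrixIncl r (p • a) ^ (k + 1)) i j)
    (fun k => by
      simp only [Matrix.smul_apply]
      exact ((Padic.tendsto_choose_pow_sub_one k).mul_const _).smul_const _)
    (Eventually.of_forall fun n k => norm_logTerm_le a n k i j)
  have hl : ∀ n, ∑' k : ℕ, ((((p ^ n - 1).choose k : ℚ_[p]) * ((k + 1 : ℕ) : ℚ_[p])⁻¹) •
      matrixIncl r (p • a) ^ (k + 1)) i j = logQuotient (matrixIncl r (1 + p • a)) n i j := by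
    intro n
    rw [matrixIncl_one_add, logQuotient_one_sub, Matrix.sum_apply, neg_neg]
    -- For `k ≥ p ^ n` the coefficient `(p ^ n - 1).choose k` is zero, so the series is the finite
    -- binomial sum.
    refine tsum_eq_sum fun k hk => ?_
    rw [Finset.mem_range, not_lt] at hk
    have : 0 < p ^ n := pow_pos (Fact.out : p.Prime).pos n
    rw [Nat.choose_eq_zero_of_lt (by omega), Nat.cast_zero, zero_mul, zero_smul,
      Matrix.zero_apply]
  simp_rw [hl] at hlim
  have hs : HasSum (fun ν : ℕ => ((ν + 1 : ℕ) : ℚ_[p])⁻¹ •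
      (1 - matrixIncl r (1 + p • a)) ^ (ν + 1)) _ := (summable_logSeries ⟨a, rfl⟩).hasSum
  have hs' := (Pi.hasSum.1 (Pi.hasSum.1 hs i) j).neg.tsum_eq
  convert hlim using 2
  rw [logSeries, Matrix.neg_apply, ← hs']
  refine tsum_congr fun k => ?_
  have e : -(((k + 1 : ℕ) : ℚ_[p])⁻¹ • (1 - matrixIncl r (1 + p • a)) ^ (k + 1)) =
      ((-1) ^ k * ((k + 1 : ℕ) : ℚ_[p])⁻¹) • matrixIncl r (p • a) ^ (k + 1) := by
    rw [matrixIncl_one_add, sub_sub_cancel]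
    rcases Nat.even_or_odd k with hk | hk
    · rw [hk.neg_one_pow, hk.add_one.neg_pow, one_mul, smul_neg, neg_neg]
    · rw [hk.neg_one_pow, hk.add_one.neg_pow, neg_one_mul, neg_smul]
  exact congrFun (congrFun e i) j

end OneUnit

end C0

/-! ### Permutation representations of `c₀(Γ)` -/

namespace C0

variable {p : ℕ} [Fact p.Prime] {Γ : Type*} [Group Γ]

section PermRep

variable (G : Type*) [DecidableEq G] [MulAction Γ G]

theorem summable_permRep (x : C0 p Γ) (g h : G) :
    Summable fun γ : Γ => x.coeff γ * (if γ • h = g then 1 else 0) := by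
  rw [NonarchimedeanAddGroup.summable_iff_tendsto_cofinite_zero]
  have h0 := x.tendsto_zero.norm
  rw [norm_zero] at h0
  refine squeeze_zero_norm (fun γ => ?_) h0
  split_ifs <;> simp

/-- The entries of the matrix through which `x` acts on the permutation module of `G`. -/
noncomputable def permEntry (x : C0 p Γ) (g h : G) : ℚ_[p] :=
  ∑' γ : Γ, x.coeff γ * (if γ • h = g then 1 else 0)

variable {G}

/-- Each entry is a sum of coefficients of `x`, so the ultrametric inequality applies. This gives
both integrality and continuity of the representation. -/
theorem norm_permEntry_le (x : C0 p Γ) (g h : G) : ‖permEntry G x g h‖ ≤ ‖x‖ := by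
  refine IsUltrametricDist.norm_tsum_le_of_forall_le_of_nonneg (norm_nonneg _) fun γ => ?_
  refine le_trans ?_ (norm_coeff_le x γ)
  split_ifs <;> simp

theorem permEntry_single (γ : Γ) (g h : G) :
    permEntry G (single γ : C0 p Γ) g h = if γ • h = g then 1 else 0 := by
  rw [permEntry, tsum_eq_single γ]
  · simp [coeff_single]
  · intro a ha
    simp [coeff_single, ha]

theorem permEntry_add (x y : C0 p Γ) (g h : G) :
    permEntry G (x + y) g h = permEntry G x g h + permEntry G y g h := by
  simp only [permEntry, coeff_add, add_mul]
  exact (summable_permRep G x g h).tsum_add (summable_permRep G y g h)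

theorem permEntry_smul (c : ℚ_[p]) (x : C0 p Γ) (g h : G) :
    permEntry G (c • x) g h = c * permEntry G x g h := by
  simp only [permEntry, coeff_smul, mul_assoc, tsum_mul_left]

theorem permEntry_mul [Fintype G] (x y : C0 p Γ) (g h : G) :
    permEntry G (x * y) g h = ∑ k, permEntry G x g k * permEntry G y k h := by
  have hs : Summable (Function.uncurry fun γ a : Γ =>
      x.coeff a * y.coeff (a⁻¹ * γ) * (if γ • h = g then 1 else 0)) := by
    rw [NonarchimedeanAddGroup.summable_iff_tendsto_cofinite_zero]
    have h0 := ((tendsto_conv x y).comp (Prod.swap_injective (α := Γ)).tendsto_cofinite).norm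
    rw [norm_zero] at h0
    refine squeeze_zero_norm (fun q => ?_) h0
    simp only [Function.uncurry, Function.comp, Prod.swap]
    split_ifs
    · rw [mul_one]
    · rw [mul_zero, norm_zero]
      exact norm_nonneg _
  -- Substitute `γ = a b` and split according to the intermediate point `k = b • h`.
  have hshift : ∀ a : Γ, ∑' γ, y.coeff (a⁻¹ * γ) * (if γ • h = g then (1 : ℚ_[p]) else 0) =
      ∑ k, (if a • k = g then 1 else 0) * permEntry G y k h := by
    intro a
    rw [← (Equiv.mulLeft a).tsum_eq]
    simp only [permEntry, ← tsum_mul_left]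
    rw [← Summable.tsum_finsetSum fun k _ => (summable_permRep G y k h).mul_left _]
    refine tsum_congr fun b => ?_
    simp only [Equiv.coe_mulLeft, inv_mul_cancel_left, mul_smul]
    rw [Finset.sum_eq_single (b • h)]
    · simp [mul_comm]
    · intro k _ hk
      simp [hk.symm]
    · simp
  calc permEntry G (x * y) g h
      = ∑' γ, ∑' a, x.coeff a * y.coeff (a⁻¹ * γ) * (if γ • h = g then 1 else 0) := by
        simp only [permEntry, coeff_mul, tsum_mul_right]
    _ = ∑' a, ∑' γ, x.coeff a * y.coeff (a⁻¹ * γ) * (if γ • h = g then 1 else 0) :=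
        hs.tsum_comm.symm
    _ = ∑' a, ∑ k, x.coeff a * (if a • k = g then 1 else 0) * permEntry G y k h := by
        simp only [mul_assoc, tsum_mul_left, hshift, Finset.mul_sum]
    _ = ∑ k, permEntry G x g k * permEntry G y k h := by
        rw [Summable.tsum_finsetSum fun k _ => (summable_permRep G x g k).mul_right _]
        simp only [tsum_mul_right, permEntry]

variable (p Γ G) in
/-- The representation of `c₀(Γ)` on the permutation module of a finite `Γ`-set. -/
noncomputable def permRep [Fintype G] : C0 p Γ →+* Matrix G G ℚ_[p] where
  toFun x := Matrix.of (permEntry G x)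
  map_one' := by
    ext g h
    simp [one_def, permEntry_single, Matrix.one_apply, eq_comm]
  map_mul' x y := by
    ext g h
    simp [Matrix.mul_apply, permEntry_mul]
  map_zero' := by
    ext g h
    simp [permEntry]
  map_add' x y := by
    ext g h
    simp [permEntry_add]

theorem permRep_apply [Fintype G] (x : C0 p Γ) (g h : G) :
    permRep p Γ G x g h = permEntry G x g h := rfl

theorem permRep_smul [Fintype G] (c : ℚ_[p]) (x : C0 p Γ) :
    permRep p Γ G (c • x) = c • permRep p Γ G x := by
  ext g h
  simp [permRep_apply, permEntry_smul]

theorem tendsto_permEntry {x : ℕ → C0 p Γ} {y : C0 p Γ} (h : Tendsto x atTop (𝓝 y)) (g k : G) :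
    Tendsto (fun n => permEntry G (x n) g k) atTop (𝓝 (permEntry G y g k)) := by
  rw [tendsto_iff_norm_sub_tendsto_zero] at h ⊢
  refine squeeze_zero (fun _ => norm_nonneg _) (fun n => ?_) h
  have e : permEntry G (x n) g k = permEntry G (x n - y) g k + permEntry G y g k := by
    rw [← permEntry_add, sub_add_cancel]
  rw [e, add_sub_cancel_right]
  exact norm_permEntry_le _ _ _

end PermRep

/-! ### Residual finiteness and the trace -/

theorem _root_.Group.ResiduallyFinite.exists_normal_finiteIndex_forall_notMem
    [Group.ResiduallyFinite Γ] {s : Set Γ} (hs : s.Finite) (h1 : 1 ∉ s) :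
    ∃ N : Subgroup Γ, N.Normal ∧ N.FiniteIndex ∧ ∀ γ ∈ s, γ ∉ N := by
  induction s, hs using Set.Finite.induction_on with
  | empty => exact ⟨⊤, inferInstance, inferInstance, by simp⟩
  | @insert γ s _ _ ih =>
    simp only [Set.mem_insert_iff, not_or] at h1
    obtain ⟨N, hN, hN', h⟩ := ih h1.2
    obtain ⟨H, hH⟩ := Group.exists_finiteIndexNormalSubgroup_notMem γ (Ne.symm h1.1)
    refine ⟨N ⊓ H.toSubgroup, inferInstance, inferInstance, ?_⟩
    rintro x (rfl | hx) hx'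
    · exact hH hx'.2
    · exact h x hx hx'.1

theorem smul_quotient_eq_self_iff {N : Subgroup Γ} [N.Normal] (γ : Γ) (g : Γ ⧸ N) :
    γ • g = g ↔ γ ∈ N := by
  induction g using QuotientGroup.induction_on with
  | H h =>
    change (γ : Γ ⧸ N) * h = h ↔ _
    rw [mul_eq_right, QuotientGroup.eq_one_iff]

open Classical in
/-- The elements of `c₀(Γ)` are separated from `0` at `1` by the traces of the representations on
the finite quotients of a residually finite group. -/
theorem coeff_one_eq_zero [Group.ResiduallyFinite Γ] {b : C0 p Γ}
    (hb : ∀ (N : Subgroup Γ) [N.Normal] [Fintype (Γ ⧸ N)],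
      (permRep p Γ (Γ ⧸ N) b).trace = 0) : b.coeff 1 = 0 := by
  rw [← norm_le_zero_iff]
  refine le_of_forall_pos_le_add fun ε hε => ?_
  rw [zero_add]
  have hfin : {γ : Γ | γ ≠ 1 ∧ ε < ‖b.coeff γ‖}.Finite := by
    have h := Metric.tendsto_nhds.1 b.tendsto_zero ε hε
    rw [eventually_cofinite] at h
    refine h.subset fun γ hγ => ?_
    simpa using hγ.2.le
  obtain ⟨N, hN, hN', hS⟩ :=
    Group.ResiduallyFinite.exists_normal_finiteIndex_forall_notMem hfin (by simp)
  have : Fintype (Γ ⧸ N) := Fintype.ofFinite _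
  -- By normality `γ` fixes a coset only if it lies in `N`, so all diagonal entries agree and the
  -- trace is the index times one of them.
  have hdiag : ∀ g : Γ ⧸ N, permRep p Γ (Γ ⧸ N) b g g =
      ∑' γ : Γ, b.coeff γ * (if γ ∈ N then 1 else 0) := fun g => by
    simp only [permRep_apply, permEntry, smul_quotient_eq_self_iff]
  have htr := hb N
  simp only [Matrix.trace, Matrix.diag_apply, hdiag, Finset.sum_const, Finset.card_univ,
    nsmul_eq_mul, mul_eq_zero, Nat.cast_eq_zero, Fintype.card_ne_zero, false_or] at htr
  have hsum : Summable fun γ : Γ => b.coeff γ * (if γ ∈ N then 1 else 0) := by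
    simpa only [smul_quotient_eq_self_iff] using
      summable_permRep (Γ ⧸ N) b ((1 : Γ) : Γ ⧸ N) ((1 : Γ) : Γ ⧸ N)
  rw [hsum.tsum_eq_add_tsum_ite 1, if_pos N.one_mem, mul_one] at htr
  rw [eq_neg_of_add_eq_zero_left htr, norm_neg]
  -- What is left is the sum over `N` without `1`, and `N` avoids every `γ ≠ 1` whose coefficient
  -- exceeds `ε`.
  refine IsUltrametricDist.norm_tsum_le_of_forall_le_of_nonneg hε.le fun γ => ?_
  split_ifs with h1 h2
  · simpa using hε.le
  · rw [mul_one]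
    by_contra hcon
    exact hS γ ⟨h1, not_le.1 hcon⟩ h2
  · simpa using hε.le

/-! ### Determinants of `1`-units -/

section DetOneUnit

variable (G : Type*) [Fintype G] [DecidableEq G] [MulAction Γ G]

variable (p Γ) in
/-- The representation of `c₀(Γ, ℤ_p)` on the permutation module of a finite `Γ`-set. -/
noncomputable def integralRep : integral p Γ →+* Matrix G G ℚ_[p] :=
  (permRep p Γ G).comp (integral p Γ).subtype

variable {G}

/-- The `p ^ n`-th power of the determinant is the determinant of `1 + p ^ n • logQuotient U n` in
the representation, whose first-order term tends to the trace of the logarithm. -/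
theorem isPadicLog_det_oneUnitsToGL (r : ℕ) (u : oneUnits p Γ r) :
    IsPadicLog (K1.det (integralRep p Γ G) (K1.ofGL (integral p Γ) r (oneUnitsToGL r u)) : ℚ_[p])
      (permRep p Γ G (logSeries (matrixIncl r u.1)).trace).trace := by
  obtain ⟨_, a, rfl⟩ := u
  set U := matrixIncl r (1 + p • a) with hU
  rw [K1.det_ofGL]
  have hval : K1.blockMatrix (integralRep p Γ G) (Fin r) (oneUnitsToGL r ⟨1 + p • a, a, rfl⟩).val =
      K1.blockMatrix (permRep p Γ G) (Fin r) U := rfl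
  have htr : (permRep p Γ G (logSeries U).trace).trace =
      (K1.blockMatrix (permRep p Γ G) (Fin r) (logSeries U)).trace := by
    simp only [Matrix.trace, Matrix.diag_apply, map_sum, Matrix.sum_apply,
      Fintype.sum_prod_type, K1.blockMatrix_apply]
    exact Finset.sum_comm
  rw [hval, htr]
  refine IsPadicLog.of_tendsto ?_
  have key := Padic.tendsto_det_sub_one_div (p := p)
    (M := fun n => K1.blockMatrix (permRep p Γ G) (Fin r) (logQuotient U n))
    (L := K1.blockMatrix (permRep p Γ G) (Fin r) (logSeries U))
    (fun n x y => (norm_permEntry_le _ _ _).trans (norm_logQuotient_le a n x.1 y.1))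
    (fun x => tendsto_permEntry (tendsto_logQuotient a x.1 x.1) x.2 x.2)
  refine key.congr fun n => ?_
  congr 2
  rw [← Matrix.det_pow, ← map_pow]
  congr 1
  have hsm : ∀ c : ℚ_[p], c • K1.blockMatrix (permRep p Γ G) (Fin r) (logQuotient U n) =
      K1.blockMatrix (permRep p Γ G) (Fin r) (c • logQuotient U n) := fun c => by
    ext x y
    simp [K1.blockMatrix_apply, permRep_smul]
  rw [hsm, ← map_one (K1.blockMatrix (permRep p Γ G) (Fin r)), ← map_add, logQuotient, smul_smul,
    mul_inv_cancel₀ (Padic.natCast_pow_ne_zero n), one_smul, add_sub_cancel]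

/-- The power of `γ` with exponent `[Γ : N]` lies in `N` and acts trivially, so the determinant is a
root of unity. -/
theorem isPadicLog_det_ofGroup (N : Subgroup Γ) [N.Normal] [Fintype (Γ ⧸ N)]
    [DecidableEq (Γ ⧸ N)] (γ : Γ) :
    IsPadicLog (K1.det (integralRep p Γ (Γ ⧸ N)) (K1.ofUnits (integral p Γ)
      ((ofGroup : Γ →* integral p Γ).toHomUnits γ)) : ℚ_[p]) 0 := by
  have hN : γ ^ Fintype.card (Γ ⧸ N) ∈ N := by
    rw [← QuotientGroup.eq_one_iff, QuotientGroup.mk_pow, pow_card_eq_one]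
  refine IsPadicLog.zero_of_pow_eq_one (m := Fintype.card (Γ ⧸ N)) Fintype.card_ne_zero ?_
  rw [← Units.val_pow_eq_pow_val, ← map_pow, ← map_pow, ← map_pow, K1.det_ofUnits]
  have h1 : integralRep p Γ (Γ ⧸ N) ((ofGroup : Γ →* integral p Γ).toHomUnits
      (γ ^ Fintype.card (Γ ⧸ N)) : (integral p Γ)ˣ) = 1 := by
    ext g h
    change permEntry (Γ ⧸ N) (single (γ ^ Fintype.card (Γ ⧸ N)) : C0 p Γ) g h = _
    rw [permEntry_single, (smul_quotient_eq_self_iff (γ ^ Fintype.card (Γ ⧸ N)) h).2 hN,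
      Matrix.one_apply]
    simp only [eq_comm]
  rw [h1, Matrix.det_one]

end DetOneUnit

end C0

/-! ### Reduction modulo `p` -/

theorem PadicInt.toZMod_eq_zero_iff {p : ℕ} [Fact p.Prime] (x : ℤ_[p]) :
    PadicInt.toZMod x = 0 ↔ ‖x‖ < 1 := by
  rw [← RingHom.mem_ker, PadicInt.ker_toZMod, IsLocalRing.mem_maximalIdeal,
    PadicInt.mem_nonunits]

/-- Finite partial sums are eventually at distance less than `1` from the sum, hence congruent to it
modulo `p`. -/
theorem PadicInt.toZMod_eq_sum_of_hasSum {p : ℕ} [Fact p.Prime] {ι : Type*} {f : ι → ℤ_[p]}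
    {a : ℤ_[p]} (h : HasSum f a) {s : Finset ι} (hs : ∀ i ∉ s, PadicInt.toZMod (f i) = 0) :
    PadicInt.toZMod a = ∑ i ∈ s, PadicInt.toZMod (f i) := by
  classical
  obtain ⟨t, ht⟩ := eventually_atTop.1 (Metric.tendsto_nhds.1 h 1 one_pos)
  have h1 := ht (s ∪ t) Finset.subset_union_right
  rw [dist_comm, dist_eq_norm, ← PadicInt.toZMod_eq_zero_iff, map_sub, sub_eq_zero, map_sum] at h1
  rw [h1]
  exact (Finset.sum_subset Finset.subset_union_left fun i _ hi => hs i hi).symm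

namespace C0

variable {p : ℕ} [Fact p.Prime] {Γ : Type*} [Group Γ]

/-- The coefficients of an element of `c₀(Γ, ℤ_p)`, as `p`-adic integers. -/
def intCoeff (x : integral p Γ) (γ : Γ) : ℤ_[p] := ⟨x.1.coeff γ, x.2 γ⟩

theorem finite_toZMod_ne_zero (x : integral p Γ) :
    (Function.support fun γ => PadicInt.toZMod (intCoeff x γ)).Finite := by
  have h := Metric.tendsto_nhds.1 x.1.tendsto_zero 1 one_pos
  rw [eventually_cofinite] at h
  refine h.subset fun γ hγ hcon => hγ ?_
  rw [dist_zero_right] at hcon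
  exact (PadicInt.toZMod_eq_zero_iff _).2 hcon

theorem hasSum_intCoeff_mul (x y : integral p Γ) (γ : Γ) :
    HasSum (fun a => intCoeff x a * intCoeff y (a⁻¹ * γ)) (intCoeff (x * y) γ) :=
  ((show Topology.IsInducing (PadicInt.Coe.ringHom (p := p)) from
    Topology.IsInducing.subtypeVal).hasSum_iff _ _).1 (summable_conv x.1 y.1 γ).hasSum

/-- Reduction of coefficients modulo `p`, from `c₀(Γ, ℤ_p)` to `𝔽_p[Γ]`. -/
noncomputable def reduction : integral p Γ →+* MonoidAlgebra (ZMod p) Γ where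
  toFun x := .ofCoeff (Finsupp.ofSupportFinite _ (finite_toZMod_ne_zero x))
  map_zero' := by
    ext γ
    exact map_zero PadicInt.toZMod
  map_one' := by
    classical
    ext γ
    change PadicInt.toZMod (intCoeff 1 γ) = _
    rw [MonoidAlgebra.one_def, MonoidAlgebra.coeff_single, Finsupp.single_apply]
    have : intCoeff (1 : integral p Γ) γ = if 1 = γ then 1 else 0 := by
      refine Subtype.ext ?_
      change (1 : C0 p Γ).coeff γ = _
      rw [one_def, coeff_single]
      simp only [eq_comm (a := γ)]
      split_ifs <;> rfl
    rw [this]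
    split_ifs <;> simp
  map_add' x y := by
    ext γ
    exact map_add PadicInt.toZMod (intCoeff x γ) (intCoeff y γ)
  map_mul' x y := by
    ext γ
    rw [MonoidAlgebra.coeff_mul_apply_left, Finsupp.sum]
    refine (PadicInt.toZMod_eq_sum_of_hasSum (hasSum_intCoeff_mul x y γ)
      (s := (Finsupp.ofSupportFinite _ (finite_toZMod_ne_zero x)).support) fun a ha => ?_).trans ?_
    · have h0 : PadicInt.toZMod (intCoeff x a) = 0 := Finsupp.notMem_support_iff.1 ha
      rw [map_mul, h0, zero_mul]
    · exact Finset.sum_congr rfl fun a _ => map_mul _ _ _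

theorem coeff_reduction (x : integral p Γ) (γ : Γ) :
    (reduction x).coeff γ = PadicInt.toZMod (intCoeff x γ) := rfl

theorem reduction_ofGroup (γ : Γ) :
    reduction (ofGroup γ : integral p Γ) = MonoidAlgebra.of (ZMod p) Γ γ := by
  classical
  ext a
  rw [coeff_reduction, MonoidAlgebra.of_apply, MonoidAlgebra.coeff_single, Finsupp.single_apply]
  have : intCoeff (ofGroup γ : integral p Γ) a = if γ = a then 1 else 0 := by
    refine Subtype.ext ?_
    change (single γ : C0 p Γ).coeff a = _
    rw [coeff_single]
    simp only [eq_comm (a := a)]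
    split_ifs <;> rfl
  rw [this]
  split_ifs <;> simp

/-- Dividing all coefficients by `p` keeps them integral and tending to `0`. -/
theorem exists_eq_smul_of_reduction_eq_zero {x : integral p Γ} (hx : reduction x = 0) :
    ∃ y : integral p Γ, x = p • y := by
  have hp : (p : ℚ_[p]) ≠ 0 := by exact_mod_cast (Fact.out : p.Prime).ne_zero
  refine ⟨⟨(p : ℚ_[p])⁻¹ • x.1, fun γ => ?_⟩, Subtype.ext ?_⟩
  · have h1 : PadicInt.toZMod (intCoeff x γ) = 0 := by rw [← coeff_reduction, hx]; rfl
    rw [← RingHom.mem_ker, PadicInt.ker_toZMod, PadicInt.maximalIdeal_eq_span_p,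
      Ideal.mem_span_singleton] at h1
    obtain ⟨y, hy⟩ := h1
    have h2 : x.1.coeff γ = p * (y : ℚ_[p]) := by
      have h3 := congrArg (PadicInt.Coe.ringHom (p := p)) hy
      rw [map_mul, map_natCast] at h3
      exact h3
    rw [coeff_smul, h2, inv_mul_cancel_left₀ hp]
    exact y.2
  · rw [AddSubmonoidClass.coe_nsmul, ← Nat.cast_smul_eq_nsmul ℚ_[p], smul_smul,
      mul_inv_cancel₀ hp, one_smul]

theorem reduction_surjective :
    Function.Surjective (reduction : integral p Γ → MonoidAlgebra (ZMod p) Γ) := by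
  classical
  intro f
  induction f using MonoidAlgebra.induction_on with
  | of γ => exact ⟨ofGroup γ, reduction_ofGroup γ⟩
  | add f g hf hg =>
    obtain ⟨x, rfl⟩ := hf
    obtain ⟨y, rfl⟩ := hg
    exact ⟨x + y, map_add _ _ _⟩
  | smul c f hf =>
    obtain ⟨x, rfl⟩ := hf
    refine ⟨c.val • x, ?_⟩
    rw [map_nsmul, ← Nat.cast_smul_eq_nsmul (ZMod p), ZMod.natCast_zmod_val]

theorem mem_oneUnits_of_map_reduction_eq_one {r : ℕ} {u : Matrix (Fin r) (Fin r) (integral p Γ)}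
    (hu : reduction.mapMatrix u = 1) : u ∈ oneUnits p Γ r := by
  have h : ∀ i j, ∃ y : integral p Γ, (u - 1) i j = p • y := fun i j => by
    refine exists_eq_smul_of_reduction_eq_zero ?_
    have h0 : reduction.mapMatrix (u - 1) = 0 := by rw [map_sub, hu, map_one, sub_self]
    exact congrFun (congrFun h0 i) j
  choose y hy using h
  refine ⟨Matrix.of y, ?_⟩
  rw [← sub_eq_iff_eq_add']
  exact Matrix.ext hy

end C0

/-! ### Functoriality of the general linear group -/

/-- It suffices to lift generators, which means lifting one off-diagonal entry. Invertible matrices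
in general need not lift. -/
theorem exists_mem_elementaryGroup_map_eq {R S : Type*} [Ring R] [Ring S] {f : R →+* S}
    (hf : Function.Surjective f) {n : Type*} [Fintype n] [DecidableEq n]
    {g : Matrix.GeneralLinearGroup n S} (hg : g ∈ elementaryGroup S n) :
    ∃ e ∈ elementaryGroup R n, Units.map f.mapMatrix.toMonoidHom e = g := by
  suffices elementaryGroup S n ≤
      (elementaryGroup R n).map (Units.map (f.mapMatrix (m := n)).toMonoidHom) from this hg
  refine (Subgroup.closure_le _).2 ?_
  rintro g ⟨i, j, c, hij, hg⟩
  obtain ⟨c, rfl⟩ := hf c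
  have h0 : ∀ d : R, Matrix.single i j d * Matrix.single i j (-d) = 0 := fun d =>
    Matrix.single_mul_single_of_ne _ _ _ _ hij.symm _
  refine ⟨⟨1 + Matrix.single i j c, 1 + Matrix.single i j (-c), ?_, ?_⟩,
    Subgroup.subset_closure ⟨i, j, c, hij, rfl⟩, Units.ext ?_⟩
  · rw [mul_add, mul_one, add_mul, one_mul, h0, add_zero, add_assoc, ← Matrix.single_add]
    simp
  · have := h0 (-c)
    rw [neg_neg] at this
    rw [mul_add, mul_one, add_mul, one_mul, this, add_zero, add_assoc, ← Matrix.single_add]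
    simp
  · rw [hg]
    change f.mapMatrix (1 + Matrix.single i j c) = _
    rw [map_add, map_one]
    congr 1
    ext a b
    simp only [RingHom.mapMatrix_apply, Matrix.map_apply, Matrix.single_apply]
    split_ifs <;> simp

theorem map_stabGL {R S : Type*} [Ring R] [Ring S] (f : R →+* S) {m n : ℕ} (h : m ≤ n)
    (a : Matrix.GeneralLinearGroup (Fin m) R) :
    Units.map f.mapMatrix.toMonoidHom (stabGL h a) =
      stabGL h (Units.map f.mapMatrix.toMonoidHom a) := by
  refine Units.ext ?_
  ext i j
  change f (stabMatrix a.val i j) = stabMatrix (f.mapMatrix a.val) i j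
  simp only [stabMatrix]
  split_ifs <;> simp

/-! ### Powers of classes in `K₁` as products of `1`-units and group elements -/

namespace C0

variable {p : ℕ} [Fact p.Prime] {Γ : Type*} [Group Γ]

/-- The class of `γ` in `K₁(c₀(Γ, ℤ_p))`. -/
noncomputable def groupClass (γ : Γ) : K1 (integral p Γ) :=
  K1.ofUnits (integral p Γ) ((ofGroup : Γ →* integral p Γ).toHomUnits γ)

/-- An element of `K₁(c₀(Γ, ℤ_p))` whose reduction in `K₁(𝔽_p[Γ])` is the class of a group element
is the product of the class of a `1`-unit and that of the group element. -/
theorem exists_oneUnit_of_reduction {m : ℕ} {a : Matrix.GeneralLinearGroup (Fin m) (integral p Γ)}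
    {γ : Γ} (h : K1.ofGL (MonoidAlgebra (ZMod p) Γ) m
      (Units.map (reduction (p := p) (Γ := Γ)).mapMatrix.toMonoidHom a) =
      K1.ofUnits _ ((MonoidAlgebra.of (ZMod p) Γ).toHomUnits γ)) :
    ∃ r, 1 ≤ r ∧ ∃ u : oneUnits p Γ r, K1.ofGL (integral p Γ) m a =
      K1.ofGL (integral p Γ) r (oneUnitsToGL r u) * groupClass γ := by
  let φ : ∀ n : ℕ, Matrix.GeneralLinearGroup (Fin n) (integral p Γ) →*
    Matrix.GeneralLinearGroup (Fin n) (MonoidAlgebra (ZMod p) Γ) :=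
    fun n => Units.map reduction.mapMatrix.toMonoidHom
  let c : Matrix.GeneralLinearGroup (Fin 1) (integral p Γ) :=
    Matrix.GeneralLinearGroup.scalar (Fin 1) ((ofGroup : Γ →* integral p Γ).toHomUnits γ)
  have hc : φ 1 c = Matrix.GeneralLinearGroup.scalar (Fin 1)
      ((MonoidAlgebra.of (ZMod p) Γ).toHomUnits γ) := by
    refine Units.ext (Matrix.ext fun i j => ?_)
    rw [Subsingleton.elim i 0, Subsingleton.elim j 0]
    exact reduction_ofGroup γ
  have hcc : K1.ofGL (integral p Γ) 1 c = groupClass γ := rfl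
  have h' : K1.ofGL _ m (φ m a) = K1.ofGL _ 1 (φ 1 c) := by rw [hc]; exact h
  let l := max m 1
  -- Dividing `a` by the matrix of `γ` makes the class of the reduction trivial, so the reduction
  -- becomes elementary after stabilization. The final `1` in the next call to
  -- `K1.exists_stabGL_mem_of_ofGL_eq_one` ensures size at least `1`.
  let b := stabGL (le_max_left m 1) a * (stabGL (le_max_right m 1) c)⁻¹
  have hb : K1.ofGL _ l (φ l b) = 1 := by
    rw [map_mul, map_mul, map_inv, map_inv, map_stabGL, map_stabGL, K1.ofGL_stab, K1.ofGL_stab,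
      ← h', mul_inv_cancel]
  obtain ⟨n, hn, hln, he⟩ := K1.exists_stabGL_mem_of_ofGL_eq_one hb 1
  obtain ⟨e, he, hee⟩ := exists_mem_elementaryGroup_map_eq 
    (f := reduction (p := p) (Γ := Γ)) reduction_surjective he
  -- Removing a lift `e` of the elementary reduction leaves a matrix congruent to `1` modulo `p`,
  -- without changing its class in `K₁`.
  have hv : φ n (e⁻¹ * stabGL hln b) = 1 := by
    rw [map_mul, map_inv, inv_mul_eq_one, map_stabGL]
    exact hee
  have hu : (e⁻¹ * stabGL hln b).val ∈ oneUnits p Γ n :=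
    mem_oneUnits_of_map_reduction_eq_one (congrArg Units.val hv)
  refine ⟨n, hn, ⟨_, hu⟩, ?_⟩
  have huu : oneUnitsToGL n ⟨_, hu⟩ = e⁻¹ * stabGL hln b := Units.ext rfl
  rw [huu, map_mul, map_inv, K1.ofGL_eq_one_of_mem he, K1.ofGL_stab, map_mul, map_inv,
    K1.ofGL_stab, K1.ofGL_stab, hcc]
  simp

/-- Torsion of the Whitehead group gives a power of `x` whose reduction is the class of some `γ`.
This is the only use of that hypothesis; existence and uniqueness of the homomorphism both rest on
it. -/
theorem exists_pow_eq_oneUnit_mul_groupClass (hWh : IsMulTorsion (WhiteheadFp p Γ))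
    (x : K1 (integral p Γ)) :
    ∃ n : ℕ, n ≠ 0 ∧ ∃ r, 1 ≤ r ∧ ∃ (u : oneUnits p Γ r) (γ : Γ),
      x ^ n = K1.ofGL (integral p Γ) r (oneUnitsToGL r u) * groupClass γ := by
  obtain ⟨m, a, rfl⟩ := K1.exists_ofGL x
  obtain ⟨n, hn, h⟩ := isOfFinOrder_iff_pow_eq_one.1 (hWh (QuotientGroup.mk
    (K1.ofGL _ m (Units.map (reduction (p := p) (Γ := Γ)).mapMatrix.toMonoidHom a))))
  rw [← QuotientGroup.mk_pow, QuotientGroup.eq_one_iff] at h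
  obtain ⟨γ, hγ⟩ := h
  rw [← map_pow, ← map_pow] at hγ
  obtain ⟨r, hr, u, hu⟩ := exists_oneUnit_of_reduction hγ.symm
  exact ⟨n, hn.ne', r, hr, u, γ, by rw [← map_pow, hu]⟩

/-! ### Logarithms of classes in `K₁` -/

/-- `c` is a value of `log_p det_Γ` at `x`: it is the trace of some `b ∈ c₀(Γ)` whose traces in all
finite quotients of `Γ` are logarithms of the corresponding determinants of `x`. -/
def IsLogDet (x : K1 (integral p Γ)) (c : ℚ_[p]) : Prop :=
  ∃ b : C0 p Γ, b.coeff 1 = c ∧ ∀ (N : Subgroup Γ) [N.Normal] [Fintype (Γ ⧸ N)]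
    [DecidableEq (Γ ⧸ N)], IsPadicLog (K1.det (integralRep p Γ (Γ ⧸ N)) x : ℚ_[p])
      (permRep p Γ (Γ ⧸ N) b).trace

namespace IsLogDet

/-- The witnesses `b` add because only their traces have to match logarithms of determinants; `b +
b'` need not be a logarithm of a product. -/
theorem mul {x y : K1 (integral p Γ)} {c d : ℚ_[p]} (hx : IsLogDet x c) (hy : IsLogDet y d) :
    IsLogDet (x * y) (c + d) := by
  obtain ⟨b, rfl, hb⟩ := hx
  obtain ⟨b', rfl, hb'⟩ := hy
  refine ⟨b + b', rfl, fun N _ _ _ => ?_⟩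
  rw [map_mul, Units.val_mul, map_add, Matrix.trace_add]
  exact (hb N).mul (hb' N)

/-- Two witnesses have equal traces in every finite quotient, so `coeff_one_eq_zero` applies to
their difference. -/
theorem unique [Group.ResiduallyFinite Γ] {x : K1 (integral p Γ)} {c d : ℚ_[p]}
    (hc : IsLogDet x c) (hd : IsLogDet x d) : c = d := by
  classical
  obtain ⟨b, rfl, hb⟩ := hc
  obtain ⟨b', rfl, hb'⟩ := hd
  refine sub_eq_zero.1 (coeff_one_eq_zero (b := b - b') fun N _ _ => ?_)
  rw [map_sub, Matrix.trace_sub, sub_eq_zero]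
  exact (hb N).unique (hb' N)

theorem of_pow {x : K1 (integral p Γ)} {c : ℚ_[p]} {n : ℕ} (hn : n ≠ 0)
    (h : IsLogDet (x ^ n) c) : IsLogDet x ((n : ℚ_[p])⁻¹ * c) := by
  obtain ⟨b, rfl, hb⟩ := h
  refine ⟨(n : ℚ_[p])⁻¹ • b, rfl, fun N _ _ _ => IsPadicLog.of_pow hn ?_⟩
  have hn' : (n : ℚ_[p]) ≠ 0 := by exact_mod_cast hn
  rw [permRep_smul, Matrix.trace_smul, smul_eq_mul, mul_inv_cancel_left₀ hn',
    ← Units.val_pow_eq_pow_val, ← map_pow]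
  exact hb N

theorem oneUnit (r : ℕ) (u : oneUnits p Γ r) :
    IsLogDet (K1.ofGL (integral p Γ) r (oneUnitsToGL r u)) (logDetOneUnits r u) :=
  ⟨_, rfl, fun _ _ _ _ => isPadicLog_det_oneUnitsToGL r u⟩

theorem groupClass (γ : Γ) : IsLogDet (groupClass γ : K1 (integral p Γ)) 0 :=
  ⟨0, rfl, fun N _ _ _ => by
    rw [map_zero, Matrix.trace_zero]
    exact isPadicLog_det_ofGroup N γ⟩

theorem exists_of_torsion (hWh : IsMulTorsion (WhiteheadFp p Γ)) (x : K1 (integral p Γ)) :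
    ∃ c, IsLogDet x c := by
  obtain ⟨n, hn, r, -, u, γ, h⟩ := exists_pow_eq_oneUnit_mul_groupClass hWh x
  exact ⟨_, of_pow hn (h ▸ (oneUnit r u).mul (groupClass γ))⟩

end IsLogDet

end C0

/-! ### The homomorphism and its uniqueness -/

theorem theorem5p1 (p : ℕ) [Fact p.Prime] (Γ : Type*) [Group Γ] [Countable Γ]
    [Group.ResiduallyFinite Γ] (hWh : IsMulTorsion (WhiteheadFp p Γ)) :
    ∃! logDet : K1 (C0.integral p Γ) →* Multiplicative ℚ_[p],
      (∀ r : ℕ, 1 ≤ r → ∀ u : C0.oneUnits p Γ r,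
        (logDet (K1.ofGL (C0.integral p Γ) r (C0.oneUnitsToGL r u))).toAdd =
          C0.logDetOneUnits r u) ∧
      (∀ γ : Γ,
        (logDet (K1.ofUnits (C0.integral p Γ)
          ((C0.ofGroup : Γ →* C0.integral p Γ).toHomUnits γ))).toAdd = 0) := by
  choose L hL using C0.IsLogDet.exists_of_torsion (p := p) hWh
  -- The values `L x` are chosen independently for each `x`; uniqueness of `IsLogDet` makes them
  -- multiplicative and forces both normalizations.
  refine ⟨MonoidHom.mk' (fun x => Multiplicative.ofAdd (L x)) fun x y =>
      (hL (x * y)).unique ((hL x).mul (hL y)),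
    ⟨fun r _ u => (hL _).unique (C0.IsLogDet.oneUnit r u),
      fun γ => (hL _).unique (C0.IsLogDet.groupClass γ)⟩, ?_⟩
  rintro f ⟨hf1, hf2⟩
  ext x
  obtain ⟨n, hn, r, hr, u, γ, h⟩ := C0.exists_pow_eq_oneUnit_mul_groupClass hWh x
  have hn' : (n : ℚ_[p]) ≠ 0 := by exact_mod_cast hn
  -- The two properties fix `f` on `x ^ n = [u][γ]`, and `n` is invertible in `ℚ_p`.
  have h1 : n • (f x).toAdd = C0.logDetOneUnits r u := by
    rw [← toAdd_pow, ← map_pow, h, map_mul, toAdd_mul, hf1 r hr, C0.groupClass, hf2, add_zero]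
  have h2 : (n : ℚ_[p])⁻¹ * C0.logDetOneUnits r u = L x := by
    refine C0.IsLogDet.unique (C0.IsLogDet.of_pow hn ?_) (hL x)
    simpa [h] using (C0.IsLogDet.oneUnit r u).mul (C0.IsLogDet.groupClass γ)
  change (f x).toAdd = L x
  rw [← h2, ← h1, nsmul_eq_mul, inv_mul_cancel_left₀ hn']
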